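/- For a unital ring $S$ let $\mathrm{GL}(S)=\varinjlim_m \mathrm{GL}_m(S)$ (along $A\mapsto A\oplus 1$), let $E(S)\subset \mathrm{GL}(S)$ be the subgroup generated by the elementary matrices, and let $K_1(S)=\mathrm{GL}(S)/E(S)$. Let $p$ be a prime number and let $R$ be a Noetherian integral domain, with field of fractions $N$ of characteristic zero, which is $p$-adically complete, i.e. the natural map $R\to\varprojlim_n R/p^nR$ is an isomorphism. Let $N^c$ be an algebraic closure of $N$, let $G$ be a finite group, and let $\mathrm{SK}_1(R[G])$ be the kernel of the homomorphism $\mathrm{Det}\colon K_1(R[G])\to K_1(N^c[G])$ induced by the inclusion $R\subset N^c$. For $n\ge 0$ put $R_n=R/p^nR$ and let $\mathrm{SK}_1(R[G])_n$ be the image of $\mathrm{SK}_1(R[G])$ under the natural map $K_1(R[G])\to K_1(R_n[G])$. Theorem. If $p^n>2$, then the natural map $K_1(R[G])\to K_1(R_n[G])$ maps $\mathrm{SK}_1(R[G])$ isomorphically onto $\mathrm{SK}_1(R[G])_n$. -/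

import Mathlib

/-! ### The infinite general linear group and `K₁` of an arbitrary unital ring -/

namespace StableK1

universe u v

/-- The `m × m` matrix `A`, extended by the identity to an `ℕ × ℕ` array of entries. -/
noncomputable def entry {S : Type u} [Ring S] {m : ℕ} (A : Matrix (Fin m) (Fin m) S) (i j : ℕ) : S :=
  if hi : i < m then
    if hj : j < m then A ⟨i, hi⟩ ⟨j, hj⟩ else 0
  else if i = j then 1 else 0

/-- The block matrix `A ⊕ 1` of size `n`, for `A` of size `m ≤ n`. -/
noncomputable def padMatrix {S : Type u} [Ring S] {m : ℕ} (n : ℕ) (A : Matrix (Fin m) (Fin m) S) :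
    Matrix (Fin n) (Fin n) S :=
  Matrix.of fun i j => entry A i j

theorem padMatrix_one {S : Type u} [Ring S] (m n : ℕ) :
    padMatrix n (1 : Matrix (Fin m) (Fin m) S) = 1 := by
  ext i j
  simp only [padMatrix, entry, Matrix.of_apply, Matrix.one_apply, Fin.ext_iff]
  split_ifs <;> first | rfl | omega

theorem padMatrix_mul {S : Type u} [Ring S] {m n : ℕ} (h : m ≤ n)
    (A B : Matrix (Fin m) (Fin m) S) :
    padMatrix n (A * B) = padMatrix n A * padMatrix n B := by
  ext i j
  rw [Matrix.mul_apply]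
  simp only [padMatrix, Matrix.of_apply]
  rw [Fin.sum_univ_eq_sum_range (fun k => entry A i k * entry B k j) n]
  by_cases hi : (i : ℕ) < m
  · rw [← Finset.sum_subset (Finset.range_mono h)
      (fun k _ hk => by
        have hk' : ¬ k < m := by simpa using hk
        simp [entry, hi, hk'])]
    rw [← Fin.sum_univ_eq_sum_range (fun k => entry A i k * entry B k j) m]
    by_cases hj : (j : ℕ) < m
    · simp [entry, hi, hj, Matrix.mul_apply]
    · simp [entry, hi, hj]
  · rw [Finset.sum_eq_single (i : ℕ)]
    · simp [entry, hi]
    · intro k _ hk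
      simp [entry, hi, Ne.symm hk]
    · intro hk
      exact absurd (Finset.mem_range.2 i.2) hk

theorem padMatrix_self {S : Type u} [Ring S] {m : ℕ} (A : Matrix (Fin m) (Fin m) S) :
    padMatrix m A = A := by
  ext i j
  simp [padMatrix, entry]

theorem padMatrix_padMatrix {S : Type u} [Ring S] {m n k : ℕ} (h : m ≤ n)
    (A : Matrix (Fin m) (Fin m) S) :
    padMatrix k (padMatrix n A) = padMatrix k A := by
  ext i j
  simp only [padMatrix, entry, Matrix.of_apply]
  split_ifs <;> first | rfl | omega

/-- The group homomorphism `GL_m(S) → GL_n(S)`, `A ↦ A ⊕ 1`, for `m ≤ n`. -/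
noncomputable def pad (S : Type u) [Ring S] (m n : ℕ) (h : m ≤ n) :
    (Matrix (Fin m) (Fin m) S)ˣ →* (Matrix (Fin n) (Fin n) S)ˣ :=
  Units.map
    { toFun := padMatrix n
      map_one' := padMatrix_one m n
      map_mul' := padMatrix_mul h }

instance pad_directedSystem (S : Type u) [Ring S] :
    DirectedSystem (fun n : ℕ => (Matrix (Fin n) (Fin n) S)ˣ)
      (fun m n h => (pad S m n h : _ → _)) where
  map_self _ x := Units.ext (padMatrix_self x.val)
  map_map _ _ _ hij _ x := Units.ext (padMatrix_padMatrix hij x.val)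

/-- The infinite general linear group `GL(S) = colim_n GL_n(S)`. -/
abbrev GLinf (S : Type u) [Ring S] : Type u :=
  DirectLimit (fun n : ℕ => (Matrix (Fin n) (Fin n) S)ˣ) (pad S)

/-- The canonical map `GL_n(S) → GL(S)`. -/
noncomputable def GLinf.of (S : Type u) [Ring S] (n : ℕ) : (Matrix (Fin n) (Fin n) S)ˣ →* GLinf S where
  toFun A := ⟦⟨n, A⟩⟧
  map_one' := (DirectLimit.one_def (f := pad S) n).symm
  map_mul' A B := (DirectLimit.mul_def (f := pad S) n A B).symm

theorem GLinf.of_pad {S : Type u} [Ring S] {m n : ℕ} (h : m ≤ n)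
    (A : (Matrix (Fin m) (Fin m) S)ˣ) : GLinf.of S n (pad S m n h A) = GLinf.of S m A :=
  (DirectLimit.eq_of_le (F := fun n : ℕ => (Matrix (Fin n) (Fin n) S)ˣ) (f := pad S) ⟨m, A⟩ n h).symm

theorem GLinf.exists_of {S : Type u} [Ring S] (x : GLinf S) :
    ∃ (n : ℕ) (A : (Matrix (Fin n) (Fin n) S)ˣ), x = GLinf.of S n A :=
  DirectLimit.exists_eq_mk (f := pad S) x

/-- The elementary matrix `e_ij(a) = 1 + a E_ij`, for `i ≠ j`. -/
noncomputable def elem {S : Type u} [Ring S] {n : ℕ} (i j : Fin n) (h : i ≠ j) (a : S) :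
    (Matrix (Fin n) (Fin n) S)ˣ where
  val := 1 + Matrix.single i j a
  inv := 1 - Matrix.single i j a
  val_inv := by
    simp [mul_sub, add_mul, Matrix.single_mul_single_of_ne _ _ _ _ h.symm]
  inv_val := by
    simp [mul_add, sub_mul, Matrix.single_mul_single_of_ne _ _ _ _ h.symm]

/-- The subgroup `E(S)` of `GL(S)` generated by the elementary matrices. -/
noncomputable def E (S : Type u) [Ring S] : Subgroup (GLinf S) :=
  Subgroup.closure
    {x | ∃ (n : ℕ) (i j : Fin n) (h : i ≠ j) (a : S), x = GLinf.of S n (elem i j h a)}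

theorem of_elem_mem {S : Type u} [Ring S] {n : ℕ} (i j : Fin n) (h : i ≠ j) (a : S) :
    GLinf.of S n (elem i j h a) ∈ E S :=
  Subgroup.subset_closure ⟨n, i, j, h, a, rfl⟩

theorem pad_elem {S : Type u} [Ring S] {m n : ℕ} (hmn : m ≤ n) (i j : Fin m) (h : i ≠ j)
    (a : S) :
    pad S m n hmn (elem i j h a) =
      elem (Fin.castLE hmn i) (Fin.castLE hmn j)
        (fun e => h (Fin.castLE_injective hmn e)) a := by
  apply Units.ext
  ext k l
  change entry (1 + Matrix.single i j a) k l =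
    (1 + Matrix.single (Fin.castLE hmn i) (Fin.castLE hmn j) a :
      Matrix (Fin n) (Fin n) S) k l
  simp only [entry, Matrix.add_apply, Matrix.one_apply, Matrix.single_apply, Fin.ext_iff,
    Fin.val_castLE]
  have hi := i.2
  have hj := j.2
  split_ifs <;> first | rfl | omega | simp

/-- A unit matrix that differs from `1` only in column `k` and off the diagonal is in `E(S)`. -/
theorem col_mem {S : Type u} [Ring S] {n : ℕ} (k : Fin n) (c : Fin n → S) (hc : c k = 0)
    (U : (Matrix (Fin n) (Fin n) S)ˣ)
    (hU : U.val = 1 + ∑ l, Matrix.single l k (c l)) : GLinf.of S n U ∈ E S := by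
  suffices H : ∀ s : Finset (Fin n), ∃ V : (Matrix (Fin n) (Fin n) S)ˣ,
      V.val = 1 + ∑ l ∈ s, Matrix.single l k (c l) ∧ GLinf.of S n V ∈ E S by
    obtain ⟨V, hV, hm⟩ := H Finset.univ
    have : U = V := Units.ext (hU.trans hV.symm)
    rwa [this]
  intro s
  induction s using Finset.induction_on with
  | empty => exact ⟨1, by simp, by rw [map_one]; exact one_mem _⟩
  | insert b s hb ih =>
    obtain ⟨V, hV, hm⟩ := ih
    by_cases hbk : b = k
    · exact ⟨V, by rw [hV, Finset.sum_insert hb, hbk, hc]; simp, hm⟩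
    · refine ⟨V * elem b k hbk (c b), ?_, ?_⟩
      · rw [Units.val_mul, hV, Finset.sum_insert hb]
        change (1 + ∑ l ∈ s, Matrix.single l k (c l)) * (1 + Matrix.single b k (c b)) = _
        have h0 : (∑ l ∈ s, Matrix.single l k (c l)) * Matrix.single b k (c b) = 0 := by
          rw [Finset.sum_mul]
          exact Finset.sum_eq_zero fun l _ =>
            Matrix.single_mul_single_of_ne _ _ _ _ (Ne.symm hbk) _
        rw [mul_add, add_mul, add_mul, h0]
        simp only [mul_one, one_mul, add_zero]
        abel
      · rw [map_mul]
        exact mul_mem hm (of_elem_mem _ _ _ _)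

/-- A unit matrix that differs from `1` only in row `k` and off the diagonal is in `E(S)`. -/
theorem row_mem {S : Type u} [Ring S] {n : ℕ} (k : Fin n) (c : Fin n → S) (hc : c k = 0)
    (U : (Matrix (Fin n) (Fin n) S)ˣ)
    (hU : U.val = 1 + ∑ l, Matrix.single k l (c l)) : GLinf.of S n U ∈ E S := by
  suffices H : ∀ s : Finset (Fin n), ∃ V : (Matrix (Fin n) (Fin n) S)ˣ,
      V.val = 1 + ∑ l ∈ s, Matrix.single k l (c l) ∧ GLinf.of S n V ∈ E S by
    obtain ⟨V, hV, hm⟩ := H Finset.univ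
    have : U = V := Units.ext (hU.trans hV.symm)
    rwa [this]
  intro s
  induction s using Finset.induction_on with
  | empty => exact ⟨1, by simp, by rw [map_one]; exact one_mem _⟩
  | insert b s hb ih =>
    obtain ⟨V, hV, hm⟩ := ih
    by_cases hbk : b = k
    · exact ⟨V, by rw [hV, Finset.sum_insert hb, hbk, hc]; simp, hm⟩
    · refine ⟨elem k b (Ne.symm hbk) (c b) * V, ?_, ?_⟩
      · rw [Units.val_mul, hV, Finset.sum_insert hb]
        change (1 + Matrix.single k b (c b)) * (1 + ∑ l ∈ s, Matrix.single k l (c l)) = _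
        have h0 : Matrix.single k b (c b) * (∑ l ∈ s, Matrix.single k l (c l)) = 0 := by
          rw [Finset.mul_sum]
          exact Finset.sum_eq_zero fun l _ =>
            Matrix.single_mul_single_of_ne _ _ _ _ hbk _
        rw [mul_add, add_mul, add_mul, h0]
        simp only [mul_one, one_mul, add_zero]
        abel
      · rw [map_mul]
        exact mul_mem (of_elem_mem _ _ _ _) hm

theorem conj_elem_col {S : Type u} [Ring S] {n : ℕ} (g : (Matrix (Fin (n + 1)) (Fin (n + 1)) S)ˣ)
    (hcol : ∀ l, l ≠ Fin.last n → g.val (Fin.last n) l = 0)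
    (hrow : ∀ l, (g⁻¹).val (Fin.last n) l = if l = Fin.last n then 1 else 0)
    (i : Fin (n + 1)) (h : i ≠ Fin.last n) (a : S) :
    GLinf.of S (n + 1) (g * elem i (Fin.last n) h a * g⁻¹) ∈ E S := by
  refine col_mem (Fin.last n) (fun l => g.val l i * a) (by simp [hcol i h]) _ ?_
  have hg : g.val * (g⁻¹).val = 1 := g.mul_inv
  rw [Units.val_mul, Units.val_mul]
  change g.val * (1 + Matrix.single i (Fin.last n) a) * (g⁻¹).val = _
  rw [mul_add, mul_one, add_mul, hg]
  congr 1
  ext r s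
  rw [Matrix.mul_apply, Matrix.sum_apply]
  simp [Matrix.mul_apply, Matrix.single_apply, hrow, ite_and, Finset.sum_ite_eq, eq_comm]

theorem conj_elem_row {S : Type u} [Ring S] {n : ℕ} (g : (Matrix (Fin (n + 1)) (Fin (n + 1)) S)ˣ)
    (hcol : ∀ l, g.val l (Fin.last n) = if l = Fin.last n then 1 else 0)
    (hrow : ∀ l, l ≠ Fin.last n → (g⁻¹).val l (Fin.last n) = 0)
    (j : Fin (n + 1)) (h : Fin.last n ≠ j) (a : S) :
    GLinf.of S (n + 1) (g * elem (Fin.last n) j h a * g⁻¹) ∈ E S := by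
  refine row_mem (Fin.last n) (fun l => a * (g⁻¹).val j l) (by simp [hrow j h.symm]) _ ?_
  have hg : g.val * (g⁻¹).val = 1 := g.mul_inv
  rw [Units.val_mul, Units.val_mul]
  change g.val * (1 + Matrix.single (Fin.last n) j a) * (g⁻¹).val = _
  rw [mul_add, mul_one, add_mul, hg]
  congr 1
  ext r s
  rw [Matrix.mul_apply, Matrix.sum_apply]
  simp [Matrix.mul_apply, Matrix.single_apply, hcol, ite_and, Finset.sum_ite_eq, eq_comm]

theorem elem_eq_commutator {S : Type u} [Ring S] {n : ℕ} (i j k : Fin n) (hij : i ≠ j)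
    (hik : i ≠ k) (hkj : k ≠ j) (a : S) :
    elem i j hij a = elem i k hik a * elem k j hkj 1 * (elem i k hik a)⁻¹ *
      (elem k j hkj 1)⁻¹ := by
  rw [eq_mul_inv_iff_mul_eq, eq_mul_inv_iff_mul_eq]
  apply Units.ext
  simp only [Units.val_mul]
  change (1 + Matrix.single i j a) * (1 + Matrix.single k j 1) * (1 + Matrix.single i k a) =
    (1 + Matrix.single i k a) * (1 + Matrix.single k j 1)
  simp [mul_add, add_mul, Matrix.single_mul_single_of_ne, hij.symm, hkj.symm]
  abel

/-- The group of elementary matrices is normal in the infinite general linear group. -/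
instance E_normal (S : Type u) [Ring S] : (E S).Normal := by
  have key : ∀ (m : ℕ) (A : (Matrix (Fin m) (Fin m) S)ˣ) (i j : Fin m) (h : i ≠ j) (a : S),
      GLinf.of S m A * GLinf.of S m (elem i j h a) * (GLinf.of S m A)⁻¹ ∈ E S := by
    intro m A i j h a
    have hm : m ≤ m + 1 := Nat.le_succ m
    set g := pad S m (m + 1) hm A with hg
    have hlast : ∀ i : Fin m, Fin.castLE hm i ≠ Fin.last m := by
      intro i e
      have := congrArg Fin.val e
      have hi := i.2
      simp at this
      omega
    have r1 : ∀ B : (Matrix (Fin m) (Fin m) S)ˣ, ∀ l,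
        (pad S m (m + 1) hm B).val (Fin.last m) l = if l = Fin.last m then 1 else 0 := by
      intro B l
      change entry B.val (Fin.last m : ℕ) l = _
      simp [entry, Fin.ext_iff, eq_comm]
    have c1 : ∀ B : (Matrix (Fin m) (Fin m) S)ˣ, ∀ l,
        (pad S m (m + 1) hm B).val l (Fin.last m) = if l = Fin.last m then 1 else 0 := by
      intro B l
      change entry B.val l (Fin.last m : ℕ) = _
      have := l.2
      simp only [entry, Fin.ext_iff, Fin.val_last]
      split_ifs <;> first | rfl | omega
    have hinv : g⁻¹ = pad S m (m + 1) hm A⁻¹ := (map_inv _ _).symm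
    have x1 := conj_elem_col g (fun l hl => by rw [hg, r1, if_neg hl])
      (fun l => by rw [hinv, r1]) (Fin.castLE hm i) (hlast i) a
    have x2 := conj_elem_row g (fun l => by rw [hg, c1])
      (fun l hl => by rw [hinv, c1, if_neg hl]) (Fin.castLE hm j) (hlast j).symm 1
    rw [← GLinf.of_pad hm A, ← GLinf.of_pad hm (elem i j h a), pad_elem, ← hg,
      elem_eq_commutator _ _ (Fin.last m) _ (hlast i) (hlast j).symm]
    have x3 := mul_mem (mul_mem x1 x2) (mul_mem (inv_mem x1) (inv_mem x2))
    convert x3 using 1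
    simp only [map_mul, map_inv]
    group
  refine ⟨fun x hx y => ?_⟩
  obtain ⟨m, A, rfl⟩ := GLinf.exists_of y
  induction hx using Subgroup.closure_induction with
  | mem x hx =>
    obtain ⟨n, i, j, h, a, rfl⟩ := hx
    rw [← GLinf.of_pad (le_max_left m n) A, ← GLinf.of_pad (le_max_right m n) (elem i j h a), pad_elem]
    exact key _ _ _ _ _ _
  | one => simp
  | mul x y _ _ hx hy =>
    convert mul_mem hx hy using 1
    group
  | inv x _ hx =>
    convert inv_mem hx using 1
    group

/-- `K₁(S) = GL(S) / E(S)`. -/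
abbrev K1 (S : Type u) [Ring S] : Type u := GLinf S ⧸ E S

/-- The homomorphism `GL_n(S) → GL_n(T)` given by a ring homomorphism `S → T`. -/
noncomputable def mapGLn {S : Type u} {T : Type v} [Ring S] [Ring T] (f : S →+* T) (n : ℕ) :
    (Matrix (Fin n) (Fin n) S)ˣ →* (Matrix (Fin n) (Fin n) T)ˣ :=
  Units.map (f.mapMatrix : Matrix (Fin n) (Fin n) S →+* Matrix (Fin n) (Fin n) T)

theorem mapGLn_pad {S : Type u} {T : Type v} [Ring S] [Ring T] (f : S →+* T) (m n : ℕ)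
    (h : m ≤ n) (A : (Matrix (Fin m) (Fin m) S)ˣ) :
    pad T m n h (mapGLn f m A) = mapGLn f n (pad S m n h A) := by
  apply Units.ext
  ext i j
  change entry (A.val.map f) i j = f (entry A.val i j)
  simp only [entry]
  split_ifs <;> simp

/-- The homomorphism `GL(S) → GL(T)` given by a ring homomorphism `S → T`. -/
noncomputable def mapGL {S : Type u} {T : Type v} [Ring S] [Ring T] (f : S →+* T) : GLinf S →* GLinf T where
  toFun := DirectLimit.map (pad S) (pad T) (fun n => mapGLn f n)
    (fun m n h A => mapGLn_pad f m n h A)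
  map_one' := by
    rw [DirectLimit.one_def 0, DirectLimit.map_def, map_one, DirectLimit.one_def 0]
  map_mul' := DirectLimit.induction₂ _ fun n A B => by
    rw [DirectLimit.mul_def, DirectLimit.map_def, DirectLimit.map_def, DirectLimit.map_def,
      map_mul, DirectLimit.mul_def]

theorem mapGL_of {S : Type u} {T : Type v} [Ring S] [Ring T] (f : S →+* T) (n : ℕ)
    (A : (Matrix (Fin n) (Fin n) S)ˣ) : mapGL f (GLinf.of S n A) = GLinf.of T n (mapGLn f n A) :=
  rfl

theorem E_le_comap {S : Type u} {T : Type v} [Ring S] [Ring T] (f : S →+* T) :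
    E S ≤ (E T).comap (mapGL f) := by
  refine (Subgroup.closure_le _).2 ?_
  rintro _ ⟨n, i, j, h, a, rfl⟩
  have : mapGLn f n (elem i j h a) = elem i j h (f a) := by
    apply Units.ext
    change f.mapMatrix (1 + Matrix.single i j a) = 1 + Matrix.single i j (f a)
    rw [map_add, map_one, RingHom.mapMatrix_apply, Matrix.map_single]
  change mapGL f (GLinf.of S n (elem i j h a)) ∈ E T
  rw [mapGL_of, this]
  exact of_elem_mem _ _ _ _

/-- The natural homomorphism `K₁(S) → K₁(T)` given by a ring homomorphism `S → T`. -/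
noncomputable def K1.map {S : Type u} {T : Type v} [Ring S] [Ring T] (f : S →+* T) : K1 S →* K1 T :=
  QuotientGroup.map (E S) (E T) (mapGL f) (E_le_comap f)

end StableK1

/-! ### `SK₁` of a group ring -/

universe u v w

/-- The homomorphism `Det : K₁(R[G]) → K₁(Nc[G])` induced by `R → Nc`; here `Nc` is meant to be
an algebraic closure of the field of fractions of `R`. -/
noncomputable def Det (R : Type u) [CommRing R] (Nc : Type v) [Field Nc] [Algebra R Nc]
    (G : Type w) [Group G] :
    StableK1.K1 (MonoidAlgebra R G) →* StableK1.K1 (MonoidAlgebra Nc G) :=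
  StableK1.K1.map (MonoidAlgebra.mapRingHom G (algebraMap R Nc))

/-- `SK₁(R[G])`, the kernel of `Det`. -/
noncomputable def SK1 (R : Type u) [CommRing R] (Nc : Type v) [Field Nc] [Algebra R Nc]
    (G : Type w) [Group G] : Subgroup (StableK1.K1 (MonoidAlgebra R G)) :=
  (Det R Nc G).ker

/-- The ring `R_n = R / pⁿR`. -/
abbrev Rmod (R : Type u) [CommRing R] (p n : ℕ) : Type u :=
  R ⧸ Ideal.span {(p : R) ^ n}

/-- The natural map `K₁(R[G]) → K₁(R_n[G])`. -/
noncomputable def reductionK1 (R : Type u) [CommRing R] (p n : ℕ) (G : Type w) [Group G] :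
    StableK1.K1 (MonoidAlgebra R G) →* StableK1.K1 (MonoidAlgebra (Rmod R p n) G) :=
  StableK1.K1.map
    (MonoidAlgebra.mapRingHom G (Ideal.Quotient.mk (Ideal.span {(p : R) ^ n})))

/-- `SK₁(R[G])_n`, the image of `SK₁(R[G])` in `K₁(R_n[G])`. -/
noncomputable def SK1mod (R : Type u) [CommRing R] (Nc : Type v) [Field Nc] [Algebra R Nc] (p n : ℕ)
    (G : Type w) [Group G] : Subgroup (StableK1.K1 (MonoidAlgebra (Rmod R p n) G)) :=
  (SK1 R Nc G).map (reductionK1 R p n G)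

/-- The natural map `SK₁(R[G]) → SK₁(R[G])_n`, the restriction of `reductionK1`. -/
noncomputable def SK1reduction (R : Type u) [CommRing R] (Nc : Type v) [Field Nc] [Algebra R Nc] (p n : ℕ)
    (G : Type w) [Group G] : SK1 R Nc G →* SK1mod R Nc p n G :=
  (reductionK1 R p n G).subgroupMap (SK1 R Nc G)

/-! Surjectivity holds because the target is defined as the image, so only injectivity is at stake.
A class killed by reduction is represented by an invertible matrix congruent to 1 modulo p^n. Since
p lies in the Jacobson radical of R, Gaussian elimination turns this matrix into a unit a = 1 + p^n
z of R[G] (`exists_unitClass_eq`). If its class lies in SK₁, then a is itself a product of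
commutators [b_g, g], one for each g in G, and commutators of units die in K₁.

The arithmetic input is `dvd_classSum_of_mem_SK1`: if a unit 1 + p^k x with k ≥ n has class in SK₁,
then p divides the sum of the coefficients of x over every conjugacy class. Over the algebraic
closure, class sums are linear combinations of traces of irreducible representations, and each of
these representations has determinant 1 on the unit. The p^M-th power of the unit is 1 + t(x + py)
with t = p^(M+k); this is where p^n > 2 enters. Expanding det(1 + tZ) = 1 + t tr Z + O(t²) shows
that tr Z is divisible by t up to a denominator independent of M
(`exists_finite_subalgebra_classSum`). For M large, Artin–Rees in a finite R-algebra absorbs that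
denominator (`exists_pow_dvd_of_smul_eq_pow_mul`).

Divisibility of the class sums makes x, modulo p, a sum of terms δ_g - g δ_g g⁻¹
(`exists_eq_sum_sub_conj_add`), and this is the first-order part of a product of commutators [1 +
p^k δ_g, g]. Hence a product of commutators equal to a modulo p^k can be corrected to one equal to a
modulo p^(k+1) (`exists_improved_approximation`), and p-adic completeness supplies the limit. -/

open scoped commutatorElement

namespace StableK1

/-! ### Classes of units in K₁ -/

section UnitClass

variable {S : Type u} [Ring S]

/-- The class in `K₁(S)` of a unit of `S`, regarded as a `1 × 1` matrix. -/
noncomputable def unitClass (S : Type u) [Ring S] : Sˣ →* K1 S :=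
  (QuotientGroup.mk' (E S)).comp
    ((GLinf.of S 1).comp (Units.map (Matrix.scalar (Fin 1)).toMonoidHom))

/-- The matrix `diag(1, b)`. -/
def diagOneUnit (b : Sˣ) : (Matrix (Fin 2) (Fin 2) S)ˣ where
  val := !![1, 0; 0, (b : S)]
  inv := !![1, 0; 0, ((b⁻¹ : Sˣ) : S)]
  val_inv := by simp [Matrix.one_fin_two]
  inv_val := by simp [Matrix.one_fin_two]

theorem pad_scalar_val (b : Sˣ) :
    (pad S 1 2 one_le_two (Units.map (Matrix.scalar (Fin 1)).toMonoidHom b)).val =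
      !![(b : S), 0; 0, 1] := by
  ext i j
  change entry _ i j = _
  fin_cases i <;> fin_cases j <;> simp [entry]

theorem of_pad_scalar (b : Sˣ) :
    (QuotientGroup.mk' (E S)) (GLinf.of S 2 (pad S 1 2 one_le_two
      (Units.map (Matrix.scalar (Fin 1)).toMonoidHom b))) = unitClass S b := by
  rw [GLinf.of_pad]; rfl

/-- The product of elementary matrices representing the Weyl element of `GL₂`. -/
noncomputable def weyl (S : Type u) [Ring S] : (Matrix (Fin 2) (Fin 2) S)ˣ :=
  elem 0 1 (by decide) 1 * elem 1 0 (by decide) (-1) * elem 0 1 (by decide) 1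

theorem weyl_val : (weyl S).val = !![0, 1; -1, 0] := by
  change (1 + Matrix.single 0 1 1) * (1 + Matrix.single 1 0 (-1)) * (1 + Matrix.single 0 1 1) = _
  ext i j
  fin_cases i <;> fin_cases j <;>
    simp [Matrix.mul_apply, Fin.sum_univ_two, Matrix.single_apply, Matrix.one_apply]

theorem mk_weyl : QuotientGroup.mk' (E S) (GLinf.of S 2 (weyl S)) = 1 := by
  rw [QuotientGroup.mk'_apply, QuotientGroup.eq_one_iff]
  simp only [weyl, map_mul]
  exact mul_mem (mul_mem (of_elem_mem _ _ _ _) (of_elem_mem _ _ _ _)) (of_elem_mem _ _ _ _)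

/-- The Weyl element conjugates diag(1, b) into diag(b, 1) and is a product of elementary matrices.
-/
theorem mk_diagOneUnit (b : Sˣ) :
    QuotientGroup.mk' (E S) (GLinf.of S 2 (diagOneUnit b)) = unitClass S b := by
  have h : weyl S * diagOneUnit b =
      pad S 1 2 one_le_two (Units.map (Matrix.scalar (Fin 1)).toMonoidHom b) * weyl S := by
    apply Units.ext
    rw [Units.val_mul, Units.val_mul, weyl_val, pad_scalar_val]
    simp [diagOneUnit]
  have h' := congrArg (fun x => QuotientGroup.mk' (E S) (GLinf.of S 2 x)) h
  simpa only [map_mul, mk_weyl, one_mul, mul_one, of_pad_scalar] using h'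

/-- The matrices diag(a, 1) and diag(1, b) commute. -/
theorem unitClass_comm (a b : Sˣ) : unitClass S a * unitClass S b = unitClass S b * unitClass S a := by
  rw [← of_pad_scalar a, ← mk_diagOneUnit b, ← map_mul, ← map_mul, ← map_mul, ← map_mul]
  congr 2
  apply Units.ext
  rw [Units.val_mul, Units.val_mul, pad_scalar_val]
  simp [diagOneUnit]

theorem unitClass_commutator (a b : Sˣ) : unitClass S ⁅a, b⁆ = 1 := by
  rw [map_commutatorElement, commutatorElement_eq_one_iff_mul_comm]
  exact unitClass_comm a b

theorem map_unitClass {T : Type v} [Ring T] (f : S →+* T) (a : Sˣ) :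
    K1.map f (unitClass S a) = unitClass T (Units.map f.toMonoidHom a) := by
  change QuotientGroup.mk' (E T) (GLinf.of T 1 (mapGLn f 1 _)) = _
  change _ = QuotientGroup.mk' (E T) (GLinf.of T 1 _)
  congr 2
  apply Units.ext
  ext i j
  fin_cases i; fin_cases j
  simp [mapGLn]

end UnitClass

/-! ### Kernel of reduction on K₁, and elimination down to a unit -/

section Lift

variable {S : Type u} {T : Type v} [Ring S] [Ring T]

theorem E_le_map (f : S →+* T) (hf : Function.Surjective f) : E T ≤ (E S).map (mapGL f) := by
  refine (Subgroup.closure_le _).2 ?_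
  rintro _ ⟨n, i, j, h, a, rfl⟩
  obtain ⟨b, rfl⟩ := hf a
  refine ⟨_, of_elem_mem i j h b, ?_⟩
  rw [mapGL_of]
  congr 1
  apply Units.ext
  change f.mapMatrix (1 + Matrix.single i j b) = 1 + Matrix.single i j (f b)
  rw [map_add, map_one, RingHom.mapMatrix_apply, Matrix.map_single]

/-- Elementary matrices lift along a surjection, so a representative can be divided by an element of
E(S) until its image in GL(T) is 1; equality in the direct limit already holds at some finite size.
-/
theorem exists_mapGLn_eq_one_of_map_eq_one (f : S →+* T) (hf : Function.Surjective f) (x : K1 S)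
    (hx : K1.map f x = 1) :
    ∃ (m : ℕ) (A : (Matrix (Fin m) (Fin m) S)ˣ), mapGLn f m A = 1 ∧
      x = QuotientGroup.mk' (E S) (GLinf.of S m A) := by
  induction x using QuotientGroup.induction_on with
  | H y =>
  have hy : mapGL f y ∈ E T := (QuotientGroup.eq_one_iff _).1 hx
  obtain ⟨e, he, hey⟩ := E_le_map f hf hy
  obtain ⟨m, A, hA⟩ := GLinf.exists_of (y * e⁻¹)
  have h1 : GLinf.of T m (mapGLn f m A) = GLinf.of T m 1 := by
    rw [← mapGL_of, ← hA, map_mul, map_inv, hey, mul_inv_cancel, map_one]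
  obtain ⟨k, hk, hk', h2⟩ : ∃ k, ∃ (hk : m ≤ k) (_ : m ≤ k),
      pad T m k hk (mapGLn f m A) = pad T m k hk 1 := Quotient.exact h1
  refine ⟨k, pad S m k hk A, ?_, ?_⟩
  · rw [← mapGLn_pad]
    exact h2.trans (map_one _)
  · rw [GLinf.of_pad, ← hA, map_mul, map_inv]
    have : QuotientGroup.mk' (E S) e = 1 := (QuotientGroup.eq_one_iff _).2 he
    rw [this]; simp

end Lift

section Elimination

variable {S : Type u} [Ring S]

theorem exists_unit_of_mul_self_eq_zero {T : Type v} [Ring T] (X : T) (h : X * X = 0) :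
    ∃ U : Tˣ, U.val = 1 + X :=
  ⟨⟨1 + X, 1 - X, by simp [mul_sub, add_mul, h], by simp [mul_add, sub_mul, h]⟩, rfl⟩

/-- Gaussian elimination with a last pivot equal to `1`. -/
theorem mk_eq_mk_of_last_eq_one {m : ℕ} (A : (Matrix (Fin (m + 1)) (Fin (m + 1)) S)ˣ)
    (hA : A.val (Fin.last m) (Fin.last m) = 1) (B : (Matrix (Fin m) (Fin m) S)ˣ)
    (hB : ∀ i j, B.val i j = A.val i.castSucc j.castSucc -
      A.val i.castSucc (Fin.last m) * A.val (Fin.last m) j.castSucc) :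
    QuotientGroup.mk' (E S) (GLinf.of S (m + 1) A) = QuotientGroup.mk' (E S) (GLinf.of S m B) := by
  set z := Fin.last m with hz
  set c : Fin (m + 1) → S := fun l => if l = z then 0 else A.val l z with hc
  set r : Fin (m + 1) → S := fun l => if l = z then 0 else A.val z l with hr
  have hX : (∑ l, Matrix.single l z (c l)) * (∑ l, Matrix.single l z (c l)) = 0 := by
    rw [Finset.sum_mul_sum]
    refine Finset.sum_eq_zero fun i _ => Finset.sum_eq_zero fun j _ => ?_
    by_cases h : z = j
    · simp [hc, ← h]
    · exact Matrix.single_mul_single_of_ne _ _ _ _ h _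
  have hY : (∑ l, Matrix.single z l (r l)) * (∑ l, Matrix.single z l (r l)) = 0 := by
    rw [Finset.sum_mul_sum]
    refine Finset.sum_eq_zero fun i _ => Finset.sum_eq_zero fun j _ => ?_
    by_cases h : i = z
    · simp [hr, h]
    · exact Matrix.single_mul_single_of_ne _ _ _ _ h _
  obtain ⟨L, hL⟩ := exists_unit_of_mul_self_eq_zero _ hX
  obtain ⟨U, hU⟩ := exists_unit_of_mul_self_eq_zero _ hY
  have hLm : QuotientGroup.mk' (E S) (GLinf.of S (m + 1) L) = 1 :=
    (QuotientGroup.eq_one_iff _).2 (col_mem z c (by simp [hc]) L hL)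
  have hUm : QuotientGroup.mk' (E S) (GLinf.of S (m + 1) U) = 1 :=
    (QuotientGroup.eq_one_iff _).2 (row_mem z r (by simp [hr]) U hU)
  -- B is the Schur complement of the pivot 1, and L and U clear its column and row.
  have key : A = L * pad S m (m + 1) m.le_succ B * U := by
    apply Units.ext
    have hp : ∀ i j, (pad S m (m + 1) m.le_succ B).val i j = entry B.val i j := fun _ _ => rfl
    have hLp : ∀ i j, (L.val * (pad S m (m + 1) m.le_succ B).val) i j =
        entry B.val i j + c i * entry B.val m j := by
      intro i j
      rw [hL, add_mul, one_mul, Matrix.add_apply, hp, Matrix.mul_apply]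
      congr 1
      simp [Matrix.sum_apply, Matrix.single_apply, ite_and, hp, hz]
    ext i j
    rw [Units.val_mul, Units.val_mul, hU, mul_add, mul_one, Matrix.add_apply, hLp, Matrix.mul_apply]
    simp only [hLp, Matrix.sum_apply, Matrix.single_apply]
    have hs : ∀ x : Fin (m + 1), (∑ l, if z = x ∧ l = j then r l else 0) =
        if z = x then r j else 0 := by
      intro x; simp [ite_and]
    simp only [hs, mul_ite, mul_zero, Finset.sum_ite_eq, Finset.mem_univ, if_true]
    induction i using Fin.lastCases with
    | last =>
      induction j using Fin.lastCases with
      | last => simpa [entry, hc, hr, hz] using hA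
      | cast j => simp [entry, hc, hr, hz, (Fin.castSucc_lt_last j).ne, j.2.ne']
    | cast i =>
      induction j using Fin.lastCases with
      | last => simp [entry, hc, hr, hz, (Fin.castSucc_lt_last i).ne]
      | cast j =>
        simp [entry, hc, hr, hz, (Fin.castSucc_lt_last j).ne, (Fin.castSucc_lt_last i).ne, hB, j.2.ne']
  rw [key, map_mul, map_mul, map_mul, map_mul, hLm, hUm, one_mul, mul_one, GLinf.of_pad]

/-- If all matrices congruent to `1` modulo the central element `c` are invertible, then every such
matrix has the class of a unit congruent to `1` modulo `c`. -/
theorem exists_unitClass_eq (c : S) (hc : ∀ s, c * s = s * c)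
    (hu : ∀ (m : ℕ) (X : Matrix (Fin m) (Fin m) S), IsUnit (1 + c • X)) (m : ℕ) :
    ∀ A : (Matrix (Fin m) (Fin m) S)ˣ, (∃ X, A.val = 1 + c • X) →
    ∃ a : Sˣ, (∃ x, a.val = 1 + c * x) ∧
      QuotientGroup.mk' (E S) (GLinf.of S m A) = unitClass S a := by
  have elem_one : ∀ {n : ℕ} (i j : Fin n) (h : i ≠ j) (a : S),
      QuotientGroup.mk' (E S) (GLinf.of S n (elem i j h a)) = 1 :=
    fun i j h a => (QuotientGroup.eq_one_iff _).2 (of_elem_mem i j h a)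
  induction m with
  | zero =>
    intro A _
    refine ⟨1, ⟨0, by simp⟩, ?_⟩
    have : A = 1 := Units.ext (Subsingleton.elim _ _)
    rw [this]; simp
  | succ m ih =>
    rintro A ⟨X, hX⟩
    rcases m with _ | m
    · have hAX : A.val 0 0 = 1 + c * X 0 0 := by rw [hX]; simp
      have hAX' : A⁻¹.val 0 0 * A.val 0 0 = 1 := by
        have := congrFun (congrFun A.inv_mul 0) 0
        simpa [Matrix.mul_apply] using this
      have hAX'' : A.val 0 0 * A⁻¹.val 0 0 = 1 := by
        have := congrFun (congrFun A.mul_inv 0) 0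
        simpa [Matrix.mul_apply] using this
      refine ⟨⟨A.val 0 0, A⁻¹.val 0 0, hAX'', hAX'⟩, ⟨X 0 0, hAX⟩, ?_⟩
      change QuotientGroup.mk' (E S) (GLinf.of S 1 _) = QuotientGroup.mk' (E S) (GLinf.of S 1 _)
      congr 2
      apply Units.ext
      ext i j
      fin_cases i; fin_cases j
      simp
    · set z := Fin.last (m + 1) with hz
      have h0 : (0 : Fin (m + 2)) ≠ z := (Fin.last_pos).ne
      -- the last diagonal entry is a unit
      obtain ⟨d, hd⟩ : IsUnit (A.val z z) := by
        obtain ⟨D, hD⟩ := hu 1 (Matrix.of fun _ _ => X z z)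
        have e : D.val 0 0 = A.val z z := by rw [hD, hX]; simp
        rw [← e]
        refine ⟨⟨D.val 0 0, D⁻¹.val 0 0, ?_, ?_⟩, rfl⟩
        · have := congrFun (congrFun D.mul_inv 0) 0
          simpa [Matrix.mul_apply] using this
        · have := congrFun (congrFun D.inv_mul 0) 0
          simpa [Matrix.mul_apply] using this
      have hdX : (d : S) = 1 + c * X z z := by rw [hd, hX]; simp
      -- make it equal to `1` by two column operations
      set t : S := d⁻¹.val * (-(X z z) - X z 0) with ht
      -- The first column operation thus turns entry (z, 0) into -c X_zz; adding column 0 to column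
      -- z then cancels the c X_zz in the pivot.
      have hdt : (d : S) * (c * t) = c * (-(X z z) - X z 0) := by
        rw [← mul_assoc, ← hc, mul_assoc, ht, ← mul_assoc d.val, Units.mul_inv, one_mul]
      set A' := A * elem z 0 h0.symm (c * t) * elem 0 z h0 1 with hA'
      have hmkA' : QuotientGroup.mk' (E S) (GLinf.of S (m + 2) A') =
          QuotientGroup.mk' (E S) (GLinf.of S (m + 2) A) := by
        rw [hA', map_mul, map_mul, map_mul, map_mul, elem_one, elem_one, mul_one, mul_one]
      have hA'e : ∀ i j, A'.val i j = A.val i j + (if j = 0 then A.val i z * (c * t) else 0) +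
          (if j = z then A.val i 0 + A.val i z * (c * t) else 0) := by
        intro i j
        change (A.val * (1 + Matrix.single z 0 (c * t) : Matrix (Fin (m + 2)) (Fin (m + 2)) S) *
          (1 + Matrix.single 0 z 1 : Matrix (Fin (m + 2)) (Fin (m + 2)) S)) i j = _
        rw [mul_add, mul_one, mul_add, mul_one, Matrix.add_apply, Matrix.add_apply,
          Matrix.mul_apply, Matrix.mul_apply]
        simp [Matrix.single_apply, ite_and, Matrix.mul_apply, eq_comm]
      have dvd_left : ∀ a b : S, c ∣ b → c ∣ a * b := by
        rintro a b ⟨x, rfl⟩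
        exact ⟨a * x, by rw [← mul_assoc, ← hc, mul_assoc]⟩
      have hone : A'.val z z = 1 := by
        rw [hA'e, if_neg h0.symm, if_pos rfl, ← hd, hdt, hdX, hX]
        simp [h0.symm, mul_sub]
      have hAd : ∀ i j, c ∣ A.val i j - (1 : Matrix _ _ S) i j := by
        intro i j
        rw [hX]
        exact ⟨X i j, by simp⟩
      -- Column z is no longer congruent to that of the identity, since column 0 was added to it.
      -- The Schur complement still is: the other entries of row z remain divisible by c.
      have hA'd : ∀ i j, j ≠ z → c ∣ A'.val i j - (1 : Matrix _ _ S) i j := by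
        intro i j hj
        rw [hA'e, if_neg hj, add_zero, add_sub_right_comm]
        refine dvd_add (hAd i j) ?_
        split_ifs
        · exact dvd_left _ _ (dvd_mul_right _ _)
        · exact dvd_zero _
      have hBd : ∀ i j : Fin (m + 1), c ∣ A'.val i.castSucc j.castSucc -
          A'.val i.castSucc z * A'.val z j.castSucc - (1 : Matrix _ _ S) i j := by
        intro i j
        have hj := (Fin.castSucc_lt_last j).ne
        rw [sub_right_comm]
        refine dvd_sub ?_ (dvd_left _ _ ?_)
        · have := hA'd i.castSucc j.castSucc hj
          simpa [Matrix.one_apply] using this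
        · have := hA'd z j.castSucc hj
          rwa [Matrix.one_apply_ne hj.symm, sub_zero] at this
      choose Y hY using hBd
      obtain ⟨B, hB⟩ := hu (m + 1) (Matrix.of Y)
      obtain ⟨a, ha, hBa⟩ := ih B ⟨_, hB⟩
      refine ⟨a, ha, ?_⟩
      rw [← hBa, ← hmkA']
      refine mk_eq_mk_of_last_eq_one A' hone B fun i j => ?_
      rw [hB, Matrix.add_apply, Matrix.smul_apply, Matrix.of_apply, smul_eq_mul, ← hY]
      abel

end Elimination

end StableK1

namespace StableK1

/-! ### Determinants on K₁ of a matrix ring -/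

section BlockDet

variable {K : Type v} [CommRing K] {d : ℕ}

/-- The determinant of a matrix whose entries are matrices. -/
noncomputable def blockDet (n : ℕ) :
    Matrix (Fin n) (Fin n) (Matrix (Fin d) (Fin d) K) →* K :=
  (Matrix.detMonoidHom (n := Fin n × Fin d) (R := K)).comp
    (Matrix.compRingEquiv (Fin n) (Fin d) K : _ →* _)

theorem blockDet_padMatrix {m n : ℕ} (h : m ≤ n)
    (A : Matrix (Fin m) (Fin m) (Matrix (Fin d) (Fin d) K)) :
    blockDet n (padMatrix n A) = blockDet m A := by
  change (Matrix.comp _ _ _ _ K (padMatrix n A)).det = (Matrix.comp _ _ _ _ K A).det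
  rw [Matrix.twoBlockTriangular_det _ (fun x : Fin n × Fin d => (x.1 : ℕ) < m)]
  · let e : Fin m × Fin d ≃ {x : Fin n × Fin d // (x.1 : ℕ) < m} :=
      { toFun := fun x => ⟨(Fin.castLE h x.1, x.2), x.1.2⟩
        invFun := fun x => (⟨x.1.1, x.2⟩, x.1.2)
        left_inv := fun x => rfl
        right_inv := fun x => rfl }
    have h1 : (Matrix.comp _ _ _ _ K A) =
        ((Matrix.comp _ _ _ _ K (padMatrix n A)).toSquareBlockProp
          (fun x : Fin n × Fin d => (x.1 : ℕ) < m)).submatrix e e := by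
      ext ⟨i, k⟩ ⟨j, l⟩
      simp [Matrix.toSquareBlockProp, padMatrix, entry, e]
    have h2 : ((Matrix.comp _ _ _ _ K (padMatrix n A)).toSquareBlockProp
          (fun x : Fin n × Fin d => ¬ (x.1 : ℕ) < m)) = 1 := by
      ext ⟨⟨i, k⟩, hi⟩ ⟨⟨j, l⟩, hj⟩
      have hi' : ¬ (i : ℕ) < m := hi
      change entry A i j k l = _
      by_cases hij : i = j
      · subst hij
        simp [entry, hi', Matrix.one_apply]
      · have : (i : ℕ) ≠ j := fun e => hij (Fin.ext e)
        simp [entry, hi', this, hij]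
    rw [h2, Matrix.det_one, mul_one, h1, Matrix.det_submatrix_equiv_self]
  · rintro ⟨i, k⟩ hi ⟨j, l⟩ hj
    have hi' : ¬ (i : ℕ) < m := hi
    have hj' : (j : ℕ) < m := hj
    have : (i : ℕ) ≠ j := fun e => hi' (e ▸ hj')
    change entry A i j k l = 0
    simp [entry, hi', this]

/-- The determinant of an invertible matrix whose entries are matrices. -/
noncomputable def blockDetUnits (K : Type v) [CommRing K] (d n : ℕ) :
    (Matrix (Fin n) (Fin n) (Matrix (Fin d) (Fin d) K))ˣ →* Kˣ :=
  Units.map (blockDet n)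

theorem blockDetUnits_pad (m n : ℕ) (h : m ≤ n)
    (A : (Matrix (Fin m) (Fin m) (Matrix (Fin d) (Fin d) K))ˣ) :
    blockDetUnits K d m A = blockDetUnits K d n (pad _ m n h A) :=
  Units.ext (blockDet_padMatrix h A.val).symm

/-- The determinant as a homomorphism on the infinite general linear group of a matrix ring. -/
noncomputable def detGLinf (K : Type v) [CommRing K] (d : ℕ) :
    GLinf (Matrix (Fin d) (Fin d) K) →* Kˣ where
  toFun := DirectLimit.lift (pad (Matrix (Fin d) (Fin d) K))
    (fun n A => blockDetUnits K d n A) blockDetUnits_pad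
  map_one' := by
    rw [DirectLimit.one_def 0, DirectLimit.lift_def, map_one]
  map_mul' := DirectLimit.induction₂ _ fun n A B => by
    rw [DirectLimit.mul_def, DirectLimit.lift_def, DirectLimit.lift_def, DirectLimit.lift_def,
      map_mul]

/-- A homomorphism from `GL(S)` to a commutative group is trivial on `E(S)`. -/
theorem E_le_ker {S : Type u} [Ring S] {H : Type v} [CommGroup H] (f : GLinf S →* H) :
    E S ≤ f.ker := by
  refine (Subgroup.closure_le _).2 ?_
  rintro _ ⟨n, i, j, h, a, rfl⟩
  have hlast : ∀ i : Fin n, Fin.castLE n.le_succ i ≠ Fin.last n := fun i e => by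
    have := congrArg Fin.val e
    simp at this
    omega
  -- Enlarging the matrix by one supplies the third index needed to write an elementary matrix as a
  -- commutator.
  rw [← GLinf.of_pad n.le_succ, pad_elem,
    elem_eq_commutator _ _ (Fin.last n) _ (hlast i) (hlast j).symm]
  change f _ = 1
  simp only [map_mul, map_inv]
  rw [mul_right_comm, mul_inv_cancel_right, mul_comm, inv_mul_cancel]

theorem det_eq_one_of_unitClass_eq_one {T : Type u} [Ring T] (φ : T →+* Matrix (Fin d) (Fin d) K)
    (a : Tˣ) (ha : unitClass T a = 1) : (φ a).det = 1 := by
  have h1 : unitClass _ (Units.map φ.toMonoidHom a) = 1 := by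
    rw [← map_unitClass, ha, map_one]
  have h2 := E_le_ker (detGLinf K d) ((QuotientGroup.eq_one_iff _).1 h1)
  have h3 := congrArg Units.val (show _ = _ from h2)
  change (Matrix.comp _ _ _ _ K _).det = 1 at h3
  rw [← h3, ← Matrix.det_submatrix_equiv_self (Equiv.uniqueProd (Fin d) (Fin 1)).symm]
  congr 1

end BlockDet

end StableK1

/-! ### Trace functions, and traces from determinants -/

section Tracial

variable {K : Type u} [Field K]

/-- Off-diagonal matrix units are commutators, and any two diagonal ones differ by a commutator. -/
theorem exists_eq_mul_trace {d : Type*} [Fintype d] [DecidableEq d] (f : Matrix d d K →ₗ[K] K)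
    (hf : ∀ x y, f (x * y) = f (y * x)) : ∃ c : K, ∀ x, f x = c * x.trace := by
  cases isEmpty_or_nonempty d with
  | inl h =>
    refine ⟨0, fun x => ?_⟩
    rw [Subsingleton.elim x 0, map_zero, zero_mul]
  | inr h =>
    obtain ⟨z⟩ := h
    have hsingle : ∀ i j a, f (Matrix.single i j a) =
        f (Matrix.single z z 1) * (Matrix.single i j a).trace := by
      intro i j a
      by_cases hij : i = j
      · subst hij
        have h1 : Matrix.single i i a = Matrix.single i z a * Matrix.single z i 1 := by simp
        have h2 : Matrix.single z i 1 * Matrix.single i z a = a • Matrix.single z z (1 : K) := by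
          simp
        rw [h1, hf, h2, map_smul, smul_eq_mul, ← h1, Matrix.trace_single_eq_same, mul_comm]
      · have h1 : Matrix.single i j a = Matrix.single i j a * Matrix.single j j 1 := by simp
        rw [Matrix.trace_single_eq_of_ne _ _ _ hij, mul_zero, h1, hf,
          Matrix.single_mul_single_of_ne _ _ _ _ (Ne.symm hij), map_zero]
    refine ⟨f (Matrix.single z z 1), fun x => ?_⟩
    conv_lhs => rw [Matrix.matrix_eq_sum_single x]
    conv_rhs => rw [Matrix.matrix_eq_sum_single x]
    rw [map_sum, Matrix.trace_sum, Finset.mul_sum]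
    refine Finset.sum_congr rfl fun i _ => ?_
    rw [map_sum, Matrix.trace_sum, Finset.mul_sum]
    exact Finset.sum_congr rfl fun j _ => hsingle _ _ _

theorem exists_eq_sum_mul_trace {ι : Type*} [Fintype ι] [DecidableEq ι] {d : ι → Type*}
    [∀ i, Fintype (d i)] [∀ i, DecidableEq (d i)]
    (f : (Π i, Matrix (d i) (d i) K) →ₗ[K] K) (hf : ∀ x y, f (x * y) = f (y * x)) :
    ∃ c : ι → K, ∀ x, f x = ∑ i, c i * (x i).trace := by
  have h : ∀ i, ∃ c : K, ∀ x, f (Pi.single i x) = c * x.trace := fun i => by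
    refine exists_eq_mul_trace (f.comp (LinearMap.single K (fun i => Matrix (d i) (d i) K) i)) fun x y => ?_
    simp only [LinearMap.comp_apply, LinearMap.single_apply, Pi.single_mul, hf]
  choose c hc using h
  refine ⟨c, fun x => ?_⟩
  conv_lhs => rw [← Finset.univ_sum_single x]
  rw [map_sum]
  exact Finset.sum_congr rfl fun i _ => hc i _

end Tracial

section DetTrace

open Polynomial

variable {K : Type u} [Field K]

/-- Substituting cX for X replaces Z by cZ, whose entries lie in A. -/
theorem pow_mul_coeff_det_mem {d : ℕ} (A : Subring K) (Z : Matrix (Fin d) (Fin d) K) (c : K)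
    (hZ : ∀ i j, c * Z i j ∈ A) (k : ℕ) :
    c ^ k * (Matrix.det (1 + (X : K[X]) • Z.map C)).coeff k ∈ A := by
  set W : Matrix (Fin d) (Fin d) A := Matrix.of fun i j => ⟨c * Z i j, hZ i j⟩ with hW
  have h1 : (Matrix.det (1 + (X : K[X]) • Z.map C)).comp (C c * X) =
      (Matrix.det (1 + (X : A[X]) • W.map C)).map A.subtype := by
    rw [← coe_compRingHom_apply, ← coe_mapRingHom, RingHom.map_det, RingHom.map_det]
    congr 1
    ext1 i j
    simp only [RingHom.mapMatrix_apply, Matrix.map_apply, Matrix.add_apply, Matrix.smul_apply,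
      smul_eq_mul, map_add, map_mul, Matrix.one_apply]
    rw [apply_ite (compRingHom (C c * X)), apply_ite (mapRingHom A.subtype)]
    simp only [map_one, map_zero, coe_compRingHom_apply, X_comp, C_comp, coe_mapRingHom, map_X,
      map_C, hW, Matrix.of_apply, Subring.subtype_apply, map_mul]
    ring
  have h2 := congrArg (fun P => P.coeff k) h1
  simp only [comp_C_mul_X_coeff, coeff_map] at h2
  rw [mul_comm, h2]
  exact SetLike.coe_mem _

/-- Write det(1 + tZ) = 1 + t tr Z + t² Q(t), cancel t, and let c^d clear the denominators of Q,
whose coefficients come from a polynomial of degree at most d. -/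
theorem pow_mul_trace_mem {d : ℕ} (A : Subring K) (Z : Matrix (Fin d) (Fin d) K) (c t : K)
    (hc : c ∈ A) (ht : t ∈ A) (ht0 : t ≠ 0) (hZ : ∀ i j, c * Z i j ∈ A)
    (hdet : Matrix.det (1 + t • Z) = 1) : ∃ q ∈ A, c ^ d * Z.trace = t * q := by
  set P := Matrix.det (1 + (X : K[X]) • Z.map C) with hP
  have h1 := Matrix.det_one_add_smul t Z
  rw [hdet, ← hP] at h1
  have h2 : Z.trace = - (P.divX.divX.eval t * t) := by
    have : t * (Z.trace + P.divX.divX.eval t * t) = 0 := by linear_combination -h1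
    have := (mul_eq_zero.1 this).resolve_left ht0
    linear_combination this
  refine ⟨-(c ^ d * P.divX.divX.eval t), neg_mem ?_, by rw [h2]; ring⟩
  have hdeg : P.natDegree ≤ d := by
    have := natDegree_det_X_add_C_le Z (1 : Matrix (Fin d) (Fin d) K)
    rw [Fintype.card_fin] at this
    rwa [Matrix.map_one C C_0 C_1, add_comm] at this
  rw [eval_eq_sum_range, Finset.mul_sum]
  refine sum_mem fun k _ => ?_
  rw [← mul_assoc]
  refine mul_mem ?_ (pow_mem ht k)
  rw [coeff_divX, coeff_divX]
  by_cases hk : k + 1 + 1 ≤ d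
  · rw [← Nat.sub_add_cancel hk, pow_add, mul_assoc]
    exact mul_mem (pow_mem hc _) (pow_mul_coeff_det_mem A Z c hZ _)
  · rw [coeff_eq_zero_of_natDegree_lt (by omega), mul_zero]
    exact zero_mem _

end DetTrace

/-! ### Removing a denominator by Artin–Rees -/

section ArtinRees

/-- Artin–Rees for Rr inside the finite module A gives p^(m+k) A ∩ Rr ⊆ p^m Rr, and r cancels. The
exponent M serves all s and q at once. -/
theorem exists_pow_dvd_of_smul_eq_pow_mul {R : Type u} {K : Type v} [CommRing R] [IsDomain R]
    [IsNoetherianRing R] [Field K] [Algebra R K] (hinj : Function.Injective (algebraMap R K))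
    (A : Subalgebra R K) [Module.Finite R A] (p r : R) (hr : r ≠ 0) (m : ℕ) :
    ∃ M : ℕ, ∀ s : R, ∀ q ∈ A, algebraMap R K (r * s) = algebraMap R K (p ^ M) * q → p ^ m ∣ s := by
  obtain ⟨k, hk⟩ := Ideal.exists_pow_inf_eq_pow_smul (M := A) (Ideal.span {p})
    (Submodule.span R {algebraMap R A r})
  refine ⟨m + k, fun s q hq h => ?_⟩
  have h1 : algebraMap R A (r * s) ∈
      Ideal.span {p} ^ (m + k) • (⊤ : Submodule R A) ⊓ Submodule.span R {algebraMap R A r} := by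
    refine ⟨?_, ?_⟩
    · have : algebraMap R A (r * s) = p ^ (m + k) • (⟨q, hq⟩ : A) := by
        apply Subtype.ext
        rw [Algebra.smul_def]
        exact h
      rw [this]
      exact Submodule.smul_mem_smul (Ideal.pow_mem_pow (Ideal.mem_span_singleton_self p) _) trivial
    · refine Submodule.mem_span_singleton.2 ⟨s, ?_⟩
      rw [Algebra.smul_def, ← map_mul, mul_comm]
  rw [hk _ (Nat.le_add_left k m), Nat.add_sub_cancel] at h1
  have h2 := Submodule.smul_mono (le_refl (Ideal.span {p} ^ m)) inf_le_right h1
  rw [Ideal.span_singleton_pow, Submodule.ideal_span_singleton_smul] at h2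
  obtain ⟨y, hy, hy'⟩ := Submodule.mem_smul_pointwise_iff_exists _ _ _ |>.1 h2
  obtain ⟨s', rfl⟩ := Submodule.mem_span_singleton.1 hy
  have h3 : algebraMap R K (p ^ m * (s' * r)) = algebraMap R K (r * s) := by
    have := congrArg Subtype.val hy'
    rw [Algebra.smul_def, Algebra.smul_def] at this
    rw [map_mul, map_mul]
    exact this
  have h4 := hinj h3
  refine ⟨s', mul_left_cancel₀ hr ?_⟩
  linear_combination -h4

end ArtinRees

/-! ### Class sums and a uniform denominator -/

section ClassSum

variable {K : Type u} [CommRing K] {G : Type w} [Group G] [Fintype G]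

open Classical in
/-- The sum of the coefficients of an element of a group ring over a conjugacy class. -/
noncomputable def classSum (K : Type u) [CommRing K] {G : Type w} [Group G] [Fintype G]
    (c : ConjClasses G) : MonoidAlgebra K G →ₗ[K] K where
  toFun x := ∑ g with ConjClasses.mk g = c, x.coeff g
  map_add' x y := by simp [Finset.sum_add_distrib]
  map_smul' a x := by simp [Finset.mul_sum]

open Classical in
theorem classSum_apply (c : ConjClasses G) (x : MonoidAlgebra K G) :
    classSum K c x = ∑ g with ConjClasses.mk g = c, x.coeff g :=
  rfl

open Classical in
theorem classSum_single (c : ConjClasses G) (g : G) (a : K) :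
    classSum K c (MonoidAlgebra.single g a) = if ConjClasses.mk g = c then a else 0 := by
  rw [classSum_apply, Finset.sum_filter, Finset.sum_eq_single g]
  · simp
  · intro h _ hh
    simp [hh.symm]
  · simp

theorem classSum_mul_comm (c : ConjClasses G) (x y : MonoidAlgebra K G) :
    classSum K c (x * y) = classSum K c (y * x) := by
  induction x using MonoidAlgebra.induction_linear with
  | zero => simp
  | add x x' hx hx' => simp [add_mul, mul_add, hx, hx']
  | single g a =>
    induction y using MonoidAlgebra.induction_linear with
    | zero => simp
    | add x x' hx hx' => simp [add_mul, mul_add, hx, hx']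
    | single h b =>
      rw [MonoidAlgebra.single_mul_single, MonoidAlgebra.single_mul_single, classSum_single,
        classSum_single, mul_comm a b]
      have : ConjClasses.mk (g * h) = ConjClasses.mk (h * g) :=
        ConjClasses.mk_eq_mk_iff_isConj.2 (isConj_iff.2 ⟨h, by group⟩)
      rw [this]

theorem classSum_mapRingHom {L : Type v} [CommRing L] (f : K →+* L) (c : ConjClasses G)
    (x : MonoidAlgebra K G) :
    classSum L c (MonoidAlgebra.mapRingHom G f x) = f (classSum K c x) := by
  simp [classSum_apply]

end ClassSum

section Denominator

/-- The point is the order of quantifiers: r and A are fixed before t and z, so that t can later run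
through arbitrarily high powers of p. -/
theorem exists_finite_subalgebra_classSum {R : Type u} [CommRing R] [IsDomain R]
    {K : Type v} [Field K] [IsAlgClosed K] [CharZero K] [Algebra R K] [Algebra.IsAlgebraic R K]
    (hinj : Function.Injective (algebraMap R K)) {G : Type w} [Group G] [Fintype G] :
    ∃ (r : R) (A : Subalgebra R K), r ≠ 0 ∧ Module.Finite R A ∧
      ∀ (t : R) (z : MonoidAlgebra R G), t ≠ 0 →
      (∀ (d : ℕ) (φ : MonoidAlgebra K G →+* Matrix (Fin d) (Fin d) K),
        (φ (MonoidAlgebra.mapRingHom G (algebraMap R K) (1 + t • z))).det = 1) →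
      ∀ c : ConjClasses G, ∃ q ∈ A, algebraMap R K (r * classSum R c z) = algebraMap R K t * q := by
  classical
  have : NeZero (Nat.card G : K) := ⟨by simp⟩
  obtain ⟨n, d, -, ⟨Φ⟩⟩ := IsSemisimpleRing.exists_algEquiv_pi_matrix_of_isAlgClosed K (MonoidAlgebra K G)
  have hf : ∀ c : ConjClasses G, ∃ a : Fin n → K, ∀ x : MonoidAlgebra K G,
      classSum K c x = ∑ i, a i * (Φ x i).trace := by
    intro c
    obtain ⟨a, ha⟩ := exists_eq_sum_mul_trace ((classSum K c).comp Φ.symm.toLinearMap)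
      (fun x y => by simpa using classSum_mul_comm c (Φ.symm x) (Φ.symm y))
    exact ⟨a, fun x => by simpa using ha (Φ x)⟩
  choose a ha using hf
  -- All scalars that need a denominator: the coefficients of class sums in terms of traces, and the
  -- matrix entries of group elements.
  set T : Set K := (Set.range fun x : ConjClasses G × Fin n => a x.1 x.2) ∪
    (Set.range fun x : G × (Σ i, Fin (d i) × Fin (d i)) =>
      Φ (MonoidAlgebra.single x.1 1) x.2.1 x.2.2.1 x.2.2.2) with hT
  have hTf : T.Finite := (Set.finite_range _).union (Set.finite_range _)
  obtain ⟨y, hy0, hy⟩ := Algebra.IsAlgebraic.exists_integral_multiples (R := R) (A := K) hTf.toFinset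
  set A : Subalgebra R K := Algebra.adjoin R ((fun x => y • x) '' T) with hA
  have hTA : ∀ x ∈ T, algebraMap R K y * x ∈ A := fun x hx => by
    rw [← Algebra.smul_def]
    exact Algebra.subset_adjoin ⟨x, hx, rfl⟩
  have hAfin : Module.Finite R A := by
    refine Module.Finite.iff_fg.2 (fg_adjoin_of_finite (hTf.image _) ?_)
    rintro _ ⟨x, hx, rfl⟩
    exact hy x (hTf.mem_toFinset.2 hx)
  -- Block i uses d i factors of y for its trace; the extra factor makes the coefficient `a c i`
  -- integral.
  refine ⟨y ^ ((∑ i, d i) + 1), A, pow_ne_zero _ hy0, hAfin, fun t z ht hz c => ?_⟩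
  set z' := MonoidAlgebra.mapRingHom G (algebraMap R K) z with hz'
  have hmap : MonoidAlgebra.mapRingHom G (algebraMap R K) (1 + t • z) =
      1 + algebraMap R K t • z' := by
    ext g
    simp [hz', Algebra.smul_def]
  have key : ∀ i, ∃ q ∈ A, algebraMap R K y ^ d i * (Φ z' i).trace = algebraMap R K t * q := by
    intro i
    refine pow_mul_trace_mem A.toSubring (Φ z' i) (algebraMap R K y) (algebraMap R K t)
      (A.algebraMap_mem y) (A.algebraMap_mem t) (by simpa using hinj.ne ht) ?_ ?_
    · intro k l
      have hsum : z' = ∑ g, algebraMap R K (z.coeff g) • MonoidAlgebra.single g (1 : K) := by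
        ext g
        simp [hz', MonoidAlgebra.coeff_sum, Finsupp.single_apply, Algebra.smul_def]
      rw [hsum, map_sum, Finset.sum_apply, Matrix.sum_apply, Finset.mul_sum]
      refine sum_mem fun g _ => ?_
      rw [map_smul, Pi.smul_apply, Matrix.smul_apply, smul_eq_mul, mul_left_comm]
      exact mul_mem (A.algebraMap_mem _) (hTA _ (Or.inr ⟨⟨g, i, k, l⟩, rfl⟩))
    · have := hz (d i) ((Pi.evalRingHom (fun i => Matrix (Fin (d i)) (Fin (d i)) K) i).comp
        (Φ : MonoidAlgebra K G →+* _))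
      rw [hmap] at this
      rw [← this]
      change _ = (Φ (1 + algebraMap R K t • z') i).det
      rw [map_add, map_one, map_smul]
      rfl
  choose q hqA hq using key
  refine ⟨∑ i, (algebraMap R K y * a c i) * algebraMap R K y ^ ((∑ i, d i) - d i) * q i,
    sum_mem fun i _ => mul_mem (mul_mem (hTA _ (Or.inl ⟨⟨c, i⟩, rfl⟩))
      (pow_mem (A.algebraMap_mem y) _)) (hqA i), ?_⟩
  rw [map_mul, ← classSum_mapRingHom, ← hz', ha, Finset.mul_sum, Finset.mul_sum]
  refine Finset.sum_congr rfl fun i _ => ?_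
  have hi : d i ≤ ∑ i, d i := Finset.single_le_sum (fun _ _ => Nat.zero_le _) (Finset.mem_univ i)
  have e : algebraMap R K (y ^ ((∑ i, d i) + 1)) = algebraMap R K y *
      (algebraMap R K y ^ ((∑ i, d i) - d i) * algebraMap R K y ^ d i) := by
    rw [← pow_add, Nat.sub_add_cancel hi, map_pow, pow_succ']
  rw [e]
  linear_combination algebraMap R K y * a c i * algebraMap R K y ^ ((∑ i, d i) - d i) * hq i

end Denominator

/-! ### Powers of 1 + p^k x and divisibility of class sums -/

section PowerCongruence

/-- For k ≥ 1 the inequality fails only when p^k = 2; this is the sole source of the bound on p^n.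
-/
theorem add_two_le_mul_of_two_lt_pow {p k : ℕ} (hp : p.Prime) (hk : 2 < p ^ k) : k + 2 ≤ p * k := by
  have h2 := hp.two_le
  rcases k with _ | _ | k
  · simp at hk
  · simp at hk; omega
  · nlinarith

theorem exists_one_add_smul_pow_prime_pow_eq {R : Type u} [CommRing R] {S : Type v} [Ring S]
    [Algebra R S] {p k : ℕ} (hp : p.Prime) (hk : 2 < p ^ k) (x : S) (N : ℕ) :
    ∃ y : S, (1 + (p : R) ^ k • x) ^ p ^ N = 1 + (p : R) ^ (N + k) • (x + (p : R) • y) := by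
  have h := add_two_le_mul_of_two_lt_pow hp hk
  have hk1 : k ≠ 0 := by rintro rfl; simp at hk
  -- Only powers of x occur, so the identity is proved in the commutative ring R[X] and evaluated at
  -- x.
  obtain ⟨P, hP⟩ := ZMod.exists_one_add_mul_pow_prime_pow_eq (R := Polynomial R) (u := (p : Polynomial R) ^ k)
    (v := p) hp (dvd_pow_self _ hk1) (by
      rw [← pow_succ', ← pow_succ, ← pow_mul]
      exact pow_dvd_pow _ (by rw [mul_comm k]; exact h)) Polynomial.X N
  have := congrArg (Polynomial.aeval x) hP
  refine ⟨Polynomial.aeval x P, ?_⟩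
  simp only [map_pow, map_add, map_mul, map_one, map_natCast, Polynomial.aeval_X] at this
  simp only [Algebra.smul_def, map_mul, map_pow, map_natCast, pow_add]
  exact this

end PowerCongruence

section ClassSumDvd

theorem dvd_classSum_of_mem_SK1 {R : Type u} [CommRing R] [IsDomain R] [IsNoetherianRing R]
    {K : Type v} [Field K] [IsAlgClosed K] [CharZero K] [Algebra R K] [Algebra.IsAlgebraic R K]
    (hinj : Function.Injective (algebraMap R K)) {G : Type w} [Group G] [Fintype G]
    {p k : ℕ} (hp : p.Prime) (hk : 2 < p ^ k) (x : MonoidAlgebra R G) (a : (MonoidAlgebra R G)ˣ)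
    (hax : (a : MonoidAlgebra R G) = 1 + (p : R) ^ k • x)
    (ha : StableK1.unitClass _ a ∈ SK1 R K G) (c : ConjClasses G) : (p : R) ∣ classSum R c x := by
  have hp0 : (p : R) ≠ 0 := by
    intro h
    have := congrArg (algebraMap R K) h
    rw [map_natCast, map_zero] at this
    exact hp.ne_zero (Nat.cast_injective (R := K) (by simpa using this))
  obtain ⟨r, A, hr, hA, H⟩ := exists_finite_subalgebra_classSum hinj (G := G)
  -- M depends only on r and A, so it may be fixed before the error term y of the power.
  obtain ⟨M, hM⟩ := exists_pow_dvd_of_smul_eq_pow_mul hinj A (p : R) r hr 1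
  obtain ⟨y, hy⟩ := exists_one_add_smul_pow_prime_pow_eq (R := R) hp hk x M
  have hdet : ∀ (d : ℕ) (φ : MonoidAlgebra K G →+* Matrix (Fin d) (Fin d) K),
      (φ (MonoidAlgebra.mapRingHom G (algebraMap R K)
        (1 + (p : R) ^ (M + k) • (x + (p : R) • y)))).det = 1 := by
    intro d φ
    have h1 : StableK1.unitClass _ (Units.map
        (MonoidAlgebra.mapRingHom G (algebraMap R K)).toMonoidHom a) = 1 := by
      rw [← StableK1.map_unitClass]
      exact ha
    have h2 := StableK1.det_eq_one_of_unitClass_eq_one φ _ h1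
    rw [← hy, ← hax, map_pow, map_pow, Matrix.det_pow]
    change (φ (MonoidAlgebra.mapRingHom G (algebraMap R K) a)).det = 1 at h2
    rw [h2, one_pow]
  obtain ⟨q, hq, hq'⟩ := H _ _ (pow_ne_zero _ hp0) hdet c
  have h3 := hM (classSum R c (x + (p : R) • y)) (algebraMap R K ((p : R) ^ k) * q)
    (mul_mem (A.algebraMap_mem _) hq) (by rw [hq', pow_add, map_mul]; ring)
  rw [pow_one, map_add, map_smul, smul_eq_mul] at h3
  exact (dvd_add_left (dvd_mul_right _ _)).1 h3

end ClassSumDvd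

/-- By Nakayama, left and right multiplication by 1 + px are surjective, giving inverses on both
sides. -/
theorem isUnit_one_add_smul_of_mem_jacobson {R : Type u} [CommRing R] {T : Type v} [Ring T]
    [Algebra R T] [Module.Finite R T] {p : R} (hp : p ∈ (⊥ : Ideal R).jacobson) (x : T) :
    IsUnit (1 + p • x) := by
  have hI : Ideal.span {p} ≤ (⊥ : Ideal R).jacobson := by
    rwa [Ideal.span_singleton_le_iff_mem]
  have key : ∀ f : T →ₗ[R] T, Function.Surjective ⇑((LinearMap.id : T →ₗ[R] T) + p • f) := fun f => by
    rw [← LinearMap.range_eq_top, ← top_le_iff]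
    refine Submodule.le_of_le_smul_of_le_jacobson_bot Module.Finite.fg_top hI fun t _ => ?_
    have : t = ((LinearMap.id : T →ₗ[R] T) + p • f) t + p • (- f t) := by simp
    rw [this]
    exact Submodule.add_mem_sup ⟨t, rfl⟩
      (Submodule.smul_mem_smul (Ideal.mem_span_singleton_self p) trivial)
  obtain ⟨y, hy⟩ := key (LinearMap.mulLeft R x) 1
  obtain ⟨z, hz⟩ := key (LinearMap.mulRight R x) 1
  have hy' : (1 + p • x) * y = 1 := by simpa [add_mul] using hy
  have hz' : z * (1 + p • x) = 1 := by simpa [mul_add] using hz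
  have : z = y := left_inv_eq_right_inv hz' hy'
  exact ⟨⟨_, y, hy', this ▸ hz'⟩, rfl⟩

/-! ### Conjugation differences and products of commutators -/

section ConjugationDifferences

/-- Move each group element to a chosen representative of its class. The differences are collected
according to the conjugating element t; what remains has the class sums as coefficients. -/
theorem exists_eq_sum_sub_conj_add {R : Type u} [CommRing R] {G : Type w} [Group G] [Fintype G]
    (p : ℕ) (x : MonoidAlgebra R G) (hx : ∀ c, (p : R) ∣ classSum R c x) :
    ∃ (δ : G → MonoidAlgebra R G) (y : MonoidAlgebra R G),
      x = ∑ g, (δ g - MonoidAlgebra.single g 1 * δ g * MonoidAlgebra.single g⁻¹ 1) + p * y := by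
  classical
  obtain ⟨o, ho⟩ := (ConjClasses.mk_surjective (α := G)).hasRightInverse
  set r : G → G := fun h => o (ConjClasses.mk h) with hr
  have hconj : ∀ h, ∃ t, t * r h * t⁻¹ = h := fun h => by
    refine isConj_iff.1 (ConjClasses.mk_eq_mk_iff_isConj.1 ?_)
    exact ho _
  choose t ht using hconj
  choose q hq using hx
  refine ⟨fun g => -∑ h with t h = g, MonoidAlgebra.single (r h) (x.coeff h),
    ∑ c : ConjClasses G, MonoidAlgebra.single (o c) (q c), ?_⟩
  have h1 : ∀ g, (-∑ h with t h = g, MonoidAlgebra.single (r h) (x.coeff h)) -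
      MonoidAlgebra.single g 1 * (-∑ h with t h = g, MonoidAlgebra.single (r h) (x.coeff h)) *
        MonoidAlgebra.single g⁻¹ 1 = ∑ h with t h = g,
        (MonoidAlgebra.single h (x.coeff h) - MonoidAlgebra.single (r h) (x.coeff h)) := by
    intro g
    rw [mul_neg, neg_mul, sub_neg_eq_add, neg_add_eq_sub, Finset.sum_sub_distrib, Finset.mul_sum,
      Finset.sum_mul]
    congr 1
    refine Finset.sum_congr rfl fun h hh => ?_
    rw [← (Finset.mem_filter.1 hh).2, MonoidAlgebra.single_mul_single,
      MonoidAlgebra.single_mul_single, ht, one_mul, mul_one]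
  have h2 : ∑ h, MonoidAlgebra.single (r h) (x.coeff h) =
      (p : MonoidAlgebra R G) * ∑ c : ConjClasses G, MonoidAlgebra.single (o c) (q c) := by
    rw [← Finset.sum_fiberwise Finset.univ ConjClasses.mk, Finset.mul_sum]
    refine Finset.sum_congr rfl fun c _ => ?_
    have : ∑ h with ConjClasses.mk h = c, MonoidAlgebra.single (r h) (x.coeff h) =
        MonoidAlgebra.single (o c) (classSum R c x) := by
      rw [classSum_apply, ← MonoidAlgebra.singleAddHom_apply, map_sum]
      refine Finset.sum_congr rfl fun h hh => ?_
      rw [← (Finset.mem_filter.1 hh).2, MonoidAlgebra.singleAddHom_apply]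
    rw [this, hq, MonoidAlgebra.natCast_def, MonoidAlgebra.single_mul_single, one_mul]
  have h3 : ∑ h, MonoidAlgebra.single h (x.coeff h) = x := by
    ext g
    simp [MonoidAlgebra.coeff_sum]
  simp only [h1]
  rw [Finset.sum_fiberwise Finset.univ t (fun h => MonoidAlgebra.single h (x.coeff h) -
    MonoidAlgebra.single (r h) (x.coeff h)), Finset.sum_sub_distrib, h3, h2, sub_add_cancel]

end ConjugationDifferences

section CommutatorProducts

/-- From [bh, u] = b [h, u] b⁻¹ [b, u]: the commutators [h, u] commute with everything they must
pass. -/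
theorem prod_map_commutatorElement_mul {H : Type u} [Group H] {ι : Type v} (b h u : ι → H)
    (hb : ∀ i j, Commute ⁅h i, u i⁆ (b j)) (hbu : ∀ i j, Commute ⁅h i, u i⁆ ⁅b j, u j⁆) (l : List ι) :
    (l.map fun i => ⁅b i * h i, u i⁆).prod =
      (l.map fun i => ⁅h i, u i⁆).prod * (l.map fun i => ⁅b i, u i⁆).prod := by
  induction l with
  | nil => simp
  | cons i l ih =>
    have h1 : ⁅b i * h i, u i⁆ = ⁅h i, u i⁆ * ⁅b i, u i⁆ := by
      have : ⁅b i * h i, u i⁆ = b i * ⁅h i, u i⁆ * (b i)⁻¹ * ⁅b i, u i⁆ := by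
        simp only [commutatorElement_def]; group
      rw [this, ← (hb i i).eq, mul_inv_cancel_right]
    have h2 : Commute (l.map fun i => ⁅h i, u i⁆).prod ⁅b i, u i⁆ := by
      refine Commute.list_prod_left _ _ fun x hx => ?_
      obtain ⟨j, -, rfl⟩ := List.mem_map.1 hx
      exact hbu j i
    simp only [List.map_cons, List.prod_cons]
    rw [ih, h1, mul_assoc, mul_assoc, ← mul_assoc _ _ (List.prod _), ← h2.eq, mul_assoc]

/-- Since ϖ is central of square zero, h⁻¹ = 1 - ϖδ and only first-order terms survive. -/
theorem val_commutatorElement_one_add {Q : Type u} [Ring Q] (ϖ : Q) (hϖ : ∀ x, Commute ϖ x)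
    (h0 : ϖ * ϖ = 0) (h u : Qˣ) (δ : Q) (hh : (h : Q) = 1 + ϖ * δ) :
    (⁅h, u⁆ : Qˣ) = 1 + ϖ * (δ - u * δ * (u⁻¹ : Qˣ)) := by
  have hi : ((h⁻¹ : Qˣ) : Q) = 1 - ϖ * δ := by
    rw [Units.inv_eq_of_mul_eq_one_right]
    rw [hh]
    have : ϖ * δ * (ϖ * δ) = 0 := by
      rw [mul_assoc, ← mul_assoc δ, ← (hϖ δ).eq, mul_assoc ϖ δ, ← mul_assoc ϖ ϖ, h0, zero_mul]
    rw [mul_sub, add_mul, add_mul, this]; simp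
  have e : (u : Q) * (1 - ϖ * δ) * (u⁻¹ : Qˣ) = 1 - ϖ * (u * δ * (u⁻¹ : Qˣ)) := by
    rw [mul_sub, sub_mul, mul_one, Units.mul_inv, ← mul_assoc _ ϖ, ← (hϖ _).eq]
    simp only [mul_assoc]
  have e2 : ∀ y : Q, ϖ * δ * (ϖ * y) = 0 := fun y => by
    rw [mul_assoc, ← mul_assoc δ, ← (hϖ δ).eq, mul_assoc ϖ δ, ← mul_assoc ϖ ϖ, h0, zero_mul]
  rw [commutatorElement_def, Units.val_mul, Units.val_mul, Units.val_mul, mul_assoc (h : Q),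
    mul_assoc (h : Q), hi, e, hh, add_mul, mul_sub, mul_sub, e2, mul_sub]
  simp only [one_mul, mul_one]
  abel

theorem val_prod_commutatorElement {Q : Type u} [Ring Q] (ϖ : Q) (hϖ : ∀ x, Commute ϖ x)
    (h0 : ϖ * ϖ = 0) {ι : Type v} (h u : ι → Qˣ) (δ : ι → Q)
    (hh : ∀ i, (h i : Q) = 1 + ϖ * δ i) (l : List ι) :
    ((l.map fun i => ⁅h i, u i⁆).prod : Qˣ) =
      1 + ϖ * (l.map fun i => δ i - u i * δ i * ((u i)⁻¹ : Qˣ)).sum := by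
  induction l with
  | nil => simp
  | cons i l ih =>
    simp only [List.map_cons, List.prod_cons, List.sum_cons, Units.val_mul]
    rw [ih, val_commutatorElement_one_add ϖ hϖ h0 _ _ _ (hh i)]
    set s := (l.map fun i => δ i - u i * δ i * ((u i)⁻¹ : Qˣ)).sum
    set d := δ i - u i * δ i * ((u i)⁻¹ : Qˣ)
    have e2 : ϖ * d * (ϖ * s) = 0 := by
      rw [mul_assoc, ← mul_assoc d, ← (hϖ d).eq, mul_assoc ϖ d, ← mul_assoc ϖ ϖ, h0, zero_mul]
    rw [mul_add, add_mul, add_mul, e2, mul_add]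
    simp only [one_mul, mul_one, add_zero]
    abel

end CommutatorProducts

/-! ### Congruences modulo p^k and p-adic limits in R[G] -/

section Congruence

variable {R : Type u} [CommRing R] {G : Type w} [Group G]

/-- Reduction of the group ring modulo `p ^ k`. -/
noncomputable def groupRingMod (R : Type u) [CommRing R] (G : Type w) [Group G] (p k : ℕ) :
    MonoidAlgebra R G →+* MonoidAlgebra (Rmod R p k) G :=
  MonoidAlgebra.mapRingHom G (Ideal.Quotient.mk (Ideal.span {(p : R) ^ k}))

theorem coeff_natCast_pow_mul (p k : ℕ) (x : MonoidAlgebra R G) (g : G) :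
    ((p : MonoidAlgebra R G) ^ k * x).coeff g = (p : R) ^ k * x.coeff g := by
  have : (p : MonoidAlgebra R G) ^ k * x = (p : R) ^ k • x := by
    rw [Algebra.smul_def, map_pow, map_natCast]
  rw [this]; simp

theorem groupRingMod_surjective (p k : ℕ) : Function.Surjective (groupRingMod R G p k) :=
  MonoidAlgebra.map_surjective _ Ideal.Quotient.mk_surjective

theorem groupRingMod_eq_iff [Finite G] {p k : ℕ} {x y : MonoidAlgebra R G} :
    groupRingMod R G p k x = groupRingMod R G p k y ↔
      ∃ z, x = y + (p : MonoidAlgebra R G) ^ k * z := by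
  constructor
  · intro h
    have h1 : ∀ g, ∃ c, x.coeff g - y.coeff g = (p : R) ^ k * c := fun g => by
      have := congrArg (fun z => z.coeff g) h
      simp only [groupRingMod, MonoidAlgebra.coeff_mapRingHom] at this
      rw [Ideal.Quotient.eq, Ideal.mem_span_singleton] at this
      exact this
    choose c hc using h1
    refine ⟨MonoidAlgebra.ofCoeff (Finsupp.equivFunOnFinite.symm c), ?_⟩
    ext g
    rw [MonoidAlgebra.coeff_add, Finsupp.add_apply, coeff_natCast_pow_mul]
    simp [← hc]
  · rintro ⟨z, rfl⟩
    ext g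
    rw [groupRingMod, MonoidAlgebra.coeff_mapRingHom, MonoidAlgebra.coeff_mapRingHom,
      Ideal.Quotient.eq, Ideal.mem_span_singleton, MonoidAlgebra.coeff_add, Finsupp.add_apply,
      coeff_natCast_pow_mul, add_sub_cancel_left]
    exact dvd_mul_right _ _

theorem natCast_pow_eq_zero_mod (p k : ℕ) : (p : MonoidAlgebra (Rmod R p k) G) ^ k = 0 := by
  have : (p : Rmod R p k) ^ k = 0 := by
    rw [← map_natCast (Ideal.Quotient.mk (Ideal.span {(p : R) ^ k})), ← map_pow,
      Ideal.Quotient.eq_zero_iff_mem]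
    exact Ideal.mem_span_singleton_self _
  rw [← map_natCast (algebraMap (Rmod R p k) (MonoidAlgebra (Rmod R p k) G)), ← map_pow, this,
    map_zero]

theorem eq_of_forall_groupRingMod_eq {p : ℕ} [IsAdicComplete (Ideal.span {(p : R)}) R]
    {x y : MonoidAlgebra R G} (h : ∀ k, groupRingMod R G p k x = groupRingMod R G p k y) :
    x = y := by
  ext g
  rw [← sub_eq_zero]
  refine IsHausdorff.haus' (I := Ideal.span {(p : R)}) _ fun k => ?_
  have := congrArg (fun z => z.coeff g) (h k)
  simp only [groupRingMod, MonoidAlgebra.coeff_mapRingHom] at this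
  rw [Ideal.Quotient.eq] at this
  rw [SModEq.zero, Ideal.span_singleton_pow]
  simpa using this

theorem exists_limit_groupRing [Finite G] {p : ℕ} [IsAdicComplete (Ideal.span {(p : R)}) R]
    (s : ℕ → MonoidAlgebra R G)
    (hs : ∀ k, groupRingMod R G p k (s (k + 1)) = groupRingMod R G p k (s k)) :
    ∃ L, ∀ k, groupRingMod R G p k L = groupRingMod R G p k (s k) := by
  have hstep : ∀ g k, (s (k + 1)).coeff g ≡ (s k).coeff g
      [SMOD (Ideal.span {(p : R)} ^ k • ⊤ : Submodule R R)] := fun g k => by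
    have := congrArg (fun z => z.coeff g) (hs k)
    simp only [groupRingMod, MonoidAlgebra.coeff_mapRingHom] at this
    rw [Ideal.Quotient.eq] at this
    rw [SModEq.sub_mem, Ideal.span_singleton_pow]
    simpa using this
  have hlim : ∀ g, ∃ L : R, ∀ k, (s k).coeff g ≡ L
      [SMOD (Ideal.span {(p : R)} ^ k • ⊤ : Submodule R R)] := fun g => by
    refine IsPrecomplete.prec' (fun k => (s k).coeff g) fun {m n} hmn => ?_
    induction n, hmn using Nat.le_induction with
    | base => rfl
    | succ n hmn ih =>
      refine ih.trans ((hstep g n).symm.mono ?_)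
      exact Submodule.smul_mono_left (Ideal.pow_le_pow_right hmn)
  choose L hL using hlim
  refine ⟨MonoidAlgebra.ofCoeff (Finsupp.equivFunOnFinite.symm L), fun k => ?_⟩
  ext g
  have := (hL g k).symm
  rw [SModEq.sub_mem, Ideal.span_singleton_pow] at this
  rw [groupRingMod, MonoidAlgebra.coeff_mapRingHom, MonoidAlgebra.coeff_mapRingHom,
    Ideal.Quotient.eq]
  simpa using this

end Congruence

/-! ### Successive approximation by products of commutators -/

section Approximation

variable {R : Type u} [CommRing R] {G : Type w} [Group G]

/-- Reduction of units of the group ring modulo `p ^ k`. -/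
noncomputable def unitsMod (R : Type u) [CommRing R] (G : Type w) [Group G] (p k : ℕ) :
    (MonoidAlgebra R G)ˣ →* (MonoidAlgebra (Rmod R p k) G)ˣ :=
  Units.map (groupRingMod R G p k).toMonoidHom

theorem unitsMod_eq_iff {p k : ℕ} {x y : (MonoidAlgebra R G)ˣ} :
    unitsMod R G p k x = unitsMod R G p k y ↔
      groupRingMod R G p k x = groupRingMod R G p k y :=
  Units.ext_iff

theorem groupRingMod_eq_of_le [Finite G] {p k l : ℕ} (h : k ≤ l) {x y : MonoidAlgebra R G}
    (hxy : groupRingMod R G p l x = groupRingMod R G p l y) :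
    groupRingMod R G p k x = groupRingMod R G p k y := by
  obtain ⟨z, rfl⟩ := groupRingMod_eq_iff.1 hxy
  refine groupRingMod_eq_iff.2 ⟨(p : MonoidAlgebra R G) ^ (l - k) * z, ?_⟩
  rw [← mul_assoc, ← pow_add, Nat.add_sub_cancel' h]

theorem unitsMod_eq_one_iff [Finite G] {p k : ℕ} {x : (MonoidAlgebra R G)ˣ} :
    unitsMod R G p k x = 1 ↔ ∃ z, (x : MonoidAlgebra R G) = 1 + (p : MonoidAlgebra R G) ^ k * z := by
  rw [← map_one (unitsMod R G p k), unitsMod_eq_iff, groupRingMod_eq_iff, Units.val_one]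

/-- The two products differ by a multiple of p^(k+n), and n ≥ 1. -/
theorem commute_unitsMod_succ [Finite G] {p k n : ℕ} (hn : n ≠ 0) {x y : (MonoidAlgebra R G)ˣ}
    (hx : unitsMod R G p k x = 1) (hy : unitsMod R G p n y = 1) :
    Commute (unitsMod R G p (k + 1) x) (unitsMod R G p (k + 1) y) := by
  obtain ⟨z, hz⟩ := unitsMod_eq_one_iff.1 hx
  obtain ⟨w, hw⟩ := unitsMod_eq_one_iff.1 hy
  obtain ⟨n, rfl⟩ := Nat.exists_eq_succ_of_ne_zero hn
  rw [commute_iff_eq, ← map_mul, ← map_mul, unitsMod_eq_iff, Units.val_mul, Units.val_mul, hz, hw]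
  refine groupRingMod_eq_iff.2 ⟨(p : MonoidAlgebra R G) ^ n * (z * w - w * z), ?_⟩
  have h1 := (Nat.cast_commute p z).pow_left (n + 1)
  have h2 := (Nat.cast_commute p w).pow_left k
  have e1 : (p : MonoidAlgebra R G) ^ k * z * ((p : MonoidAlgebra R G) ^ (n + 1) * w) =
      (p : MonoidAlgebra R G) ^ (k + 1 + n) * (z * w) := by
    rw [mul_assoc, ← mul_assoc z, ← h1.eq, mul_assoc, ← mul_assoc, ← pow_add]
    congr 2; omega
  have e2 : (p : MonoidAlgebra R G) ^ (n + 1) * w * ((p : MonoidAlgebra R G) ^ k * z) =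
      (p : MonoidAlgebra R G) ^ (k + 1 + n) * (w * z) := by
    rw [mul_assoc, ← mul_assoc w, ← h2.eq, mul_assoc, ← mul_assoc, ← pow_add]
    congr 2; omega
  rw [← mul_assoc, ← pow_add, mul_add, add_mul, add_mul, mul_add, add_mul, add_mul, e1, e2, mul_sub]
  simp only [one_mul, mul_one]
  abel

/-- A group element as a unit of the group ring. -/
noncomputable def groupUnit (R : Type u) [CommRing R] {G : Type w} [Group G] (g : G) :
    (MonoidAlgebra R G)ˣ :=
  Units.map (MonoidAlgebra.of R G) (toUnits g)

/-- The product over `g` in `G` of the commutators of `b g` and `g`. -/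
noncomputable def commutatorProd [Fintype G] (b : G → (MonoidAlgebra R G)ˣ) : (MonoidAlgebra R G)ˣ :=
  (Finset.univ.toList.map fun g => ⁅b g, groupUnit R g⁆).prod

theorem unitClass_commutatorProd [Fintype G] (b : G → (MonoidAlgebra R G)ˣ) :
    StableK1.unitClass _ (commutatorProd b) = 1 := by
  rw [commutatorProd, map_list_prod]
  refine List.prod_eq_one fun x hx => ?_
  simp only [List.map_map, List.mem_map] at hx
  obtain ⟨g, -, rfl⟩ := hx
  exact StableK1.unitClass_commutator _ _

theorem unitsMod_commutatorProd [Fintype G] (p k : ℕ) (b : G → (MonoidAlgebra R G)ˣ) :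
    unitsMod R G p k (commutatorProd b) = (Finset.univ.toList.map fun g =>
      ⁅unitsMod R G p k (b g), unitsMod R G p k (groupUnit R g)⁆).prod := by
  rw [commutatorProd, map_list_prod, List.map_map]
  congr 2
  ext1 g
  exact map_commutatorElement _ _ _

theorem exists_improved_approximation [Fintype G] {p n k : ℕ} (hn : n ≠ 0) (hk : n ≤ k)
    (hu : ∀ x : MonoidAlgebra R G, IsUnit (1 + (p : MonoidAlgebra R G) * x))
    (H : Subgroup (StableK1.K1 (MonoidAlgebra R G)))
    (hH : ∀ (x : MonoidAlgebra R G) (h : (MonoidAlgebra R G)ˣ),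
      (h : MonoidAlgebra R G) = 1 + (p : MonoidAlgebra R G) ^ k * x →
      StableK1.unitClass _ h ∈ H → ∀ c, (p : R) ∣ classSum R c x)
    (a : (MonoidAlgebra R G)ˣ) (ha : StableK1.unitClass _ a ∈ H)
    (b : G → (MonoidAlgebra R G)ˣ) (hb : ∀ g, unitsMod R G p n (b g) = 1)
    (hab : unitsMod R G p k (commutatorProd b) = unitsMod R G p k a) :
    ∃ b' : G → (MonoidAlgebra R G)ˣ, (∀ g, unitsMod R G p n (b' g) = 1) ∧
      unitsMod R G p (k + 1) (commutatorProd b') = unitsMod R G p (k + 1) a ∧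
      ∀ g, unitsMod R G p k (b' g) = unitsMod R G p k (b g) := by
  have hk0 : k ≠ 0 := by omega
  set θ := groupRingMod R G p (k + 1) with hθ
  set Θ := unitsMod R G p (k + 1) with hΘ
  have hq : unitsMod R G p k (a * (commutatorProd b)⁻¹) = 1 := by
    rw [map_mul, map_inv, hab, mul_inv_cancel]
  obtain ⟨x, hx⟩ := unitsMod_eq_one_iff.1 hq
  -- Dividing a by a product of commutators leaves its class in K₁ unchanged, so `hH` applies to the
  -- quotient.
  obtain ⟨δ, y, hxy⟩ := exists_eq_sum_sub_conj_add p x (hH x _ hx (by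
    rw [map_mul, map_inv, unitClass_commutatorProd, inv_one, mul_one]
    exact ha))
  have hunit : ∀ g, ∃ h : (MonoidAlgebra R G)ˣ,
      (h : MonoidAlgebra R G) = 1 + (p : MonoidAlgebra R G) ^ k * δ g := fun g => by
    obtain ⟨h, hh⟩ := hu ((p : MonoidAlgebra R G) ^ (k - 1) * δ g)
    refine ⟨h, ?_⟩
    rw [hh, ← mul_assoc, ← pow_succ', Nat.sub_add_cancel (Nat.one_le_iff_ne_zero.2 hk0)]
  choose h hh using hunit
  have hh1 : ∀ g, unitsMod R G p k (h g) = 1 := fun g => unitsMod_eq_one_iff.2 ⟨_, hh g⟩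
  have hcomm1 : ∀ g, unitsMod R G p k ⁅h g, groupUnit R g⁆ = 1 := fun g => by
    rw [map_commutatorElement, hh1, commutatorElement_one_left]
  have hbcomm1 : ∀ g, unitsMod R G p n ⁅b g, groupUnit R g⁆ = 1 := fun g => by
    rw [map_commutatorElement, hb, commutatorElement_one_left]
  have hnk : ∀ {v : (MonoidAlgebra R G)ˣ}, unitsMod R G p k v = 1 → unitsMod R G p n v = 1 := by
    intro v hv
    rw [← map_one (unitsMod R G p k), unitsMod_eq_iff] at hv
    rw [← map_one (unitsMod R G p n), unitsMod_eq_iff]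
    exact groupRingMod_eq_of_le hk hv
  -- The correction h_g = 1 + p^k δ_g is invisible modulo p^k, and its commutators supply the
  -- missing factor modulo p^(k+1).
  refine ⟨fun g => b g * h g, fun g => by rw [map_mul, hb, hnk (hh1 g), mul_one], ?_,
    fun g => by rw [map_mul, hh1, mul_one]⟩
  have hsplit : Θ (commutatorProd fun g => b g * h g) =
      Θ (commutatorProd h) * Θ (commutatorProd b) := by
    rw [hΘ, unitsMod_commutatorProd, unitsMod_commutatorProd, unitsMod_commutatorProd]
    simp only [map_mul]
    refine prod_map_commutatorElement_mul (fun g => unitsMod R G p (k + 1) (b g))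
      (fun g => unitsMod R G p (k + 1) (h g))
      (fun g => unitsMod R G p (k + 1) (groupUnit R g)) (fun i j => ?_) (fun i j => ?_) _
    · simpa only [map_commutatorElement] using commute_unitsMod_succ hn (hcomm1 i) (hb j)
    · simpa only [map_commutatorElement] using commute_unitsMod_succ hn (hcomm1 i) (hbcomm1 j)
  have hprod : Θ (commutatorProd h) = Θ (a * (commutatorProd b)⁻¹) := by
    apply Units.ext
    rw [hΘ, unitsMod_commutatorProd]
    have hϖ0 : (p : MonoidAlgebra (Rmod R p (k + 1)) G) ^ (k + 1) = 0 := natCast_pow_eq_zero_mod p _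
    rw [val_prod_commutatorElement ((p : MonoidAlgebra (Rmod R p (k + 1)) G) ^ k)
      (fun x => (Nat.cast_commute p x).pow_left k)
      (by rw [← pow_add]; exact pow_eq_zero_of_le (by omega) hϖ0)
      (fun g => unitsMod R G p (k + 1) (h g)) (fun g => unitsMod R G p (k + 1) (groupUnit R g))
      (fun g => θ (δ g)) (fun g => by
        change θ (h g : MonoidAlgebra R G) = _
        rw [hh, map_add, map_one, map_mul, map_pow, map_natCast])]
    change _ = θ ((a * (commutatorProd b)⁻¹ : (MonoidAlgebra R G)ˣ) : MonoidAlgebra R G)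
    rw [hx, map_add, map_one, map_mul, map_pow, map_natCast, hxy, map_add, mul_add, map_mul,
      map_natCast, ← mul_assoc, ← pow_succ, hϖ0, zero_mul, add_zero, map_sum, Finset.sum_map_toList]
    congr 2
    refine Finset.sum_congr rfl fun g _ => ?_
    rw [map_sub, map_mul, map_mul]
    rfl
  rw [hsplit, hprod, map_mul, map_inv, inv_mul_cancel_right]

theorem unitClass_eq_one_of_forall_dvd_classSum [Fintype G] {p n : ℕ} (hn : n ≠ 0)
    [IsAdicComplete (Ideal.span {(p : R)}) R]
    (hu : ∀ x : MonoidAlgebra R G, IsUnit (1 + (p : MonoidAlgebra R G) * x))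
    (H : Subgroup (StableK1.K1 (MonoidAlgebra R G)))
    (hH : ∀ k, n ≤ k → ∀ (x : MonoidAlgebra R G) (h : (MonoidAlgebra R G)ˣ),
      (h : MonoidAlgebra R G) = 1 + (p : MonoidAlgebra R G) ^ k * x →
      StableK1.unitClass _ h ∈ H → ∀ c, (p : R) ∣ classSum R c x)
    (a : (MonoidAlgebra R G)ˣ) (ha : StableK1.unitClass _ a ∈ H)
    (han : unitsMod R G p n a = 1) : StableK1.unitClass _ a = 1 := by
  let P : ℕ → Type (max u w) := fun j => {b : G → (MonoidAlgebra R G)ˣ //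
    (∀ g, unitsMod R G p n (b g) = 1) ∧
      unitsMod R G p (n + j) (commutatorProd b) = unitsMod R G p (n + j) a}
  have hstep : ∀ j (b : P j), ∃ b' : P (j + 1),
      ∀ g, unitsMod R G p (n + j) (b'.1 g) = unitsMod R G p (n + j) (b.1 g) := by
    rintro j ⟨b, hb, hab⟩
    obtain ⟨b', h1, h2, h3⟩ := exists_improved_approximation hn (Nat.le_add_right n j) hu H
      (hH _ (Nat.le_add_right n j)) a ha b hb hab
    exact ⟨⟨b', h1, h2⟩, h3⟩
  choose next hnext using hstep
  let b0 : P 0 := ⟨fun _ => 1, fun _ => map_one _, by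
    rw [unitsMod_commutatorProd, add_zero, han]
    simp⟩
  let s : ∀ j, P j := fun j => Nat.rec b0 next j
  obtain ⟨t, ht1, ht, ht'⟩ : ∃ t : ℕ → G → (MonoidAlgebra R G)ˣ,
      (∀ g, unitsMod R G p n (t 0 g) = 1) ∧
      (∀ j, unitsMod R G p (n + j) (commutatorProd (t j)) = unitsMod R G p (n + j) a) ∧
      ∀ j g, unitsMod R G p (n + j) (t (j + 1) g) = unitsMod R G p (n + j) (t j g) :=
    ⟨fun j => (s j).1, (s 0).2.1, fun j => (s j).2.2, fun j g => hnext j (s j) g⟩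
  have hlim : ∀ g, ∃ L : MonoidAlgebra R G, ∀ j,
      groupRingMod R G p (n + j) L = groupRingMod R G p (n + j) (t j g) := by
    intro g
    -- Truncated subtraction makes the sequence constant up to index n, so the congruences below
    -- level n are trivial.
    obtain ⟨L, hL⟩ := exists_limit_groupRing (p := p)
      (fun k => (t (k - n) g : MonoidAlgebra R G)) (fun k => by
        by_cases hk : n ≤ k
        · obtain ⟨j, rfl⟩ := Nat.exists_eq_add_of_le hk
          rw [add_assoc, Nat.add_sub_cancel_left, Nat.add_sub_cancel_left]
          exact unitsMod_eq_iff.1 (ht' j g)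
        · rw [show k + 1 - n = k - n by omega])
    exact ⟨L, fun j => by simpa using hL (n + j)⟩
  choose L hL using hlim
  -- The limit is congruent to 1 modulo p^n with n ≥ 1, hence is a unit.
  have hunit : ∀ g, ∃ v : (MonoidAlgebra R G)ˣ, (v : MonoidAlgebra R G) = L g := fun g => by
    have h0 := (hL g 0).trans (unitsMod_eq_iff.1 ((ht1 g).trans (map_one _).symm))
    obtain ⟨z, hz⟩ := groupRingMod_eq_iff.1 h0
    obtain ⟨v, hv⟩ := hu ((p : MonoidAlgebra R G) ^ (n - 1) * z)
    refine ⟨v, ?_⟩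
    rw [hv, hz, ← mul_assoc, ← pow_succ', Nat.sub_add_cancel (Nat.one_le_iff_ne_zero.2 hn),
      Units.val_one, add_zero]
  choose b hb using hunit
  have hfin : a = commutatorProd b := by
    apply Units.ext
    refine eq_of_forall_groupRingMod_eq (p := p) fun k => ?_
    refine groupRingMod_eq_of_le (Nat.le_add_left k n) ?_
    rw [← unitsMod_eq_iff, ← ht, unitsMod_commutatorProd, unitsMod_commutatorProd]
    congr 2
    ext1 g
    have : unitsMod R G p (n + k) (b g) = unitsMod R G p (n + k) (t k g) := by
      rw [unitsMod_eq_iff, hb, hL]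
    rw [this]
  rw [hfin, unitClass_commutatorProd]

end Approximation

theorem theorem5 {R : Type*} [CommRing R] [IsDomain R] [IsNoetherianRing R]
    {N : Type*} [Field N] [Algebra R N] [IsFractionRing R N] [CharZero N]
    {Nc : Type*} [Field Nc] [Algebra N Nc] [IsAlgClosure N Nc]
    [Algebra R Nc] [IsScalarTower R N Nc]
    {p : ℕ} (hp : p.Prime) [IsAdicComplete (Ideal.span {(p : R)}) R]
    {G : Type*} [Group G] [Finite G]
    (n : ℕ) (hn : 2 < p ^ n) :
    Function.Bijective (SK1reduction R Nc p n G) := by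
  refine ⟨?_, MonoidHom.subgroupMap_surjective _ _⟩
  have := Fintype.ofFinite G
  have : IsAlgClosed Nc := IsAlgClosure.isAlgClosed N
  have : Algebra.IsAlgebraic N Nc := IsAlgClosure.isAlgebraic
  have : CharZero Nc := charZero_of_injective_algebraMap (algebraMap N Nc).injective
  have : Algebra.IsAlgebraic R Nc := (IsFractionRing.comap_isAlgebraic_iff (K := N)).2 inferInstance
  have hinj : Function.Injective (algebraMap R Nc) := by
    rw [IsScalarTower.algebraMap_eq R N Nc]
    exact (algebraMap N Nc).injective.comp (IsFractionRing.injective R N)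
  have hn0 : n ≠ 0 := by rintro rfl; simp at hn
  have hpJ : (p : R) ∈ (⊥ : Ideal R).jacobson :=
    IsAdicComplete.le_jacobson_bot _ (Ideal.mem_span_singleton_self (p : R))
  have hu : ∀ x : MonoidAlgebra R G, IsUnit (1 + (p : MonoidAlgebra R G) * x) := fun x => by
    have := isUnit_one_add_smul_of_mem_jacobson hpJ x
    rwa [Algebra.smul_def, map_natCast] at this
  rw [injective_iff_map_eq_one]
  rintro ⟨x, hx⟩ hx1
  have hx2 : StableK1.K1.map (groupRingMod R G p n) x = 1 := congrArg Subtype.val hx1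
  obtain ⟨m, A, hA, rfl⟩ :=
    StableK1.exists_mapGLn_eq_one_of_map_eq_one _ (groupRingMod_surjective p n) x hx2
  have hAe : ∀ i j, ∃ z, A.val i j =
      (1 : Matrix _ _ (MonoidAlgebra R G)) i j + (p : MonoidAlgebra R G) ^ n * z := fun i j => by
    refine groupRingMod_eq_iff.1 ?_
    have := congrFun (congrFun (congrArg (fun M => M.val) hA) i) j
    change groupRingMod R G p n (A.val i j) =
      (1 : Matrix (Fin m) (Fin m) (MonoidAlgebra (Rmod R p n) G)) i j at this
    rw [this, Matrix.one_apply, Matrix.one_apply]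
    split_ifs <;> simp
  choose X hX using hAe
  obtain ⟨a, ⟨z, hz⟩, haA⟩ := StableK1.exists_unitClass_eq ((p : MonoidAlgebra R G) ^ n)
    (fun s => (Nat.cast_commute p s).pow_left n) (fun m Y => by
      have := isUnit_one_add_smul_of_mem_jacobson (T := Matrix (Fin m) (Fin m) (MonoidAlgebra R G))
        (Ideal.pow_mem_of_mem _ hpJ n (Nat.pos_of_ne_zero hn0)) Y
      have e : (p : MonoidAlgebra R G) ^ n • Y = (p : R) ^ n • Y := by
        ext1 i j
        rw [Matrix.smul_apply, Matrix.smul_apply, Algebra.smul_def, map_pow, map_natCast, smul_eq_mul]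
      rwa [e])
    m A ⟨Matrix.of X, by ext1 i j; rw [hX]; rfl⟩
  have hmain : StableK1.unitClass _ a = 1 := by
    rw [haA] at hx
    refine unitClass_eq_one_of_forall_dvd_classSum hn0 hu (SK1 R Nc G) (fun k hk y h hy hh => ?_) a hx
      (unitsMod_eq_one_iff.2 ⟨z, hz⟩)
    refine dvd_classSum_of_mem_SK1 hinj hp
      (hn.trans_le (Nat.pow_le_pow_right hp.pos hk)) y h ?_ hh
    rw [hy, Algebra.smul_def, map_pow, map_natCast]
  exact Subtype.ext (haA.trans hmain)
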